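/- **Setting.** Let $d\ge 1$, $\gamma>1$, and consider the compressible Euler equations with conservative variables $\mathbf u=(\rho,\rho\mathbf V,\rho E)\in\mathbb R^{d+2}$, pressure $P=(\gamma-1)(\rho E-\tfrac12\rho|\mathbf V|^2)$ and flux $\mathbf F(\mathbf u)=(\rho\mathbf V,\ \rho\mathbf V\otimes\mathbf V+P\mathbf I,\ (\rho E+P)\mathbf V)$, whose columns are $\mathbf F_1,\dots,\mathbf F_d$. Let $s=\log(P/\rho^\gamma)$, let $H=-\rho s/(\gamma-1)$ be the generalized entropy and $\boldsymbol{\mathcal F}=H\mathbf V=-\rho s\mathbf V/(\gamma-1)$ the entropy flux, and let $$\boldsymbol v(\mathbf u)=\frac{\partial H}{\partial\mathbf u}=\Big(\frac{\gamma-s}{\gamma-1}-\beta\frac{|\mathbf V|^2}{2},\ \beta\mathbf V,\ -\beta\Big),\qquad \beta=\rho/P,$$ be the entropy variables, with inverse $\mathbf u(\boldsymbol v)$, defined for $\boldsymbol v$ with negative last component (the admissible $\boldsymbol v$). Functions of $\mathbf u$ are regarded as functions of $\boldsymbol v$ through $\mathbf u(\boldsymbol v)$. The entropy potential is $\boldsymbol\Psi=\rho\mathbf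 V$. Let $\mathcal T_h$ be a conforming mesh of finitely many nondegenerate simplices in $\mathbb R^d$, $\Omega$ the interior of their union, the simplices being grouped into macro-elements. Write $\int_{\mathcal T_h}$ for the sum of the integrals over all elements, $\int_{\partial\mathcal T_h}$ for the sum of the surface integrals over the boundaries of all macro-elements (so that a face between two macro-elements occurs twice, once from each side), and $\boldsymbol n$ for the unit normal pointing out of the macro-element. For $p\ge0$ let $\boldsymbol{\mathcal V}_h$ be the space of $\mathbb R^{d+2}$-valued functions that are polynomial of degree at most $p$ on each simplex and continuous on each macro-element, with no continuity between macro-elements. Let $\boldsymbol{\mathcal M}_h$ be the space of single-valued $\mathbb R^{d+2}$-valued functions that are polynomial of degree at most $p$ on each simplex facet lying on a macro-element boundary, or any linear subspace of it (for instance the functions that are moreover continuous on each face of a macro-element). Let $\widehat{\mathbf F}_h=\widehat{\mathbf F}_h(\widehat{\boldsymbol v}_h,\boldsymbol v_h;\boldsymbol n)$ be any inviscid numerical flux and $\widehat{\mathbf B}_h=\widehat{\mathbf B}_h(\widehat{\boldsymbol v}_h,\boldsymbol v_h;\boldsymbol v_h^{\partial\Omega},\boldsymbol n)$ any boundary trace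 operator, with boundary data $\boldsymbol v_h^{\partial\Omega}$. Let $T>0$ and let $(\boldsymbol v_h(t),\widehat{\boldsymbol v}_h(t))\in\boldsymbol{\mathcal V}_h\times\boldsymbol{\mathcal M}_h$, $t\in[0,T]$, with admissible values and $\boldsymbol v_h$ differentiable in $t$, solve the macro-element entropy-variable HDG semi-discretization $$\int_{\mathcal T_h}\frac{\partial\mathbf u(\boldsymbol v_h)}{\partial t}\cdot\boldsymbol w-\int_{\mathcal T_h}\sum_{j=1}^d\mathbf F_j(\boldsymbol v_h)\cdot\partial_j\boldsymbol w+\int_{\partial\mathcal T_h}\widehat{\mathbf F}_h\cdot\boldsymbol w=0,\qquad \int_{\partial\mathcal T_h\setminus\partial\Omega}\widehat{\mathbf F}_h\cdot\boldsymbol\mu+\int_{\partial\Omega}\widehat{\mathbf B}_h\cdot\boldsymbol\mu=0$$ for all $(\boldsymbol w,\boldsymbol\mu)\in\boldsymbol{\mathcal V}_h\times\boldsymbol{\mathcal M}_h$ and all $t\in[0,T]$, where $\widehat{\mathbf F}_h$ is integrable on the macro-element boundaries and $\widehat{\mathbf B}_h$ on $\partial\Omega$. **Proposition.** For all admissible $\boldsymbol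 v$ and all $j$, $\Psi_j=\mathbf F_j^T\boldsymbol v-\mathcal F_j$. Moreover, with $[\![a]\!]=\widehat a-a$ and $\Psi_n=\boldsymbol\Psi\cdot\boldsymbol n=\rho\mathbf V\cdot\boldsymbol n$, the total generalized entropy is differentiable on $[0,T]$ and for all $t\in[0,T]$ $$\frac{d}{dt}\int_{\mathcal T_h}H(\mathbf u(\boldsymbol v_h))-\int_{\partial\mathcal T_h}\big([\![\boldsymbol v_h]\!]^T\widehat{\mathbf F}_h-[\![\Psi_n]\!]\big)+\mathbf B_{\partial\Omega}=0,$$ where $[\![\Psi_n]\!]=\Psi_n(\widehat{\boldsymbol v}_h)-\Psi_n(\boldsymbol v_h)$ and the boundary term is $$\mathbf B_{\partial\Omega}=\int_{\partial\Omega}\mathcal F_n(\widehat{\boldsymbol v}_h)-\int_{\partial\Omega}\widehat{\boldsymbol v}_h^T\mathbf F_n(\widehat{\boldsymbol v}_h)+\int_{\partial\Omega}\widehat{\boldsymbol v}_h^T(\widehat{\mathbf F}_h-\widehat{\mathbf B}_h),$$ with $\mathcal F_n=\boldsymbol{\mathcal F}\cdot\boldsymbol n$ and $\mathbf F_n=\sum_j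 n_j\mathbf F_j$. -/

import Mathlib

open MeasureTheory Set
open scoped MeasureTheory

namespace HDG

/-- Physical space, with its Euclidean structure. -/
abbrev Pt (d : ℕ) := EuclideanSpace ℝ (Fin d)

/-- State vectors, with `d + 2` components: one scalar (mass), `d` momentum components and one
scalar (energy). Used both for conservative variables `(ρ, ρV, ρE)` and for entropy variables. -/
abbrev State (d : ℕ) := Fin (d + 2) → ℝ

namespace State

variable {d : ℕ}

/-- The state with given first entry, middle block and last entry. -/
def mk (a : ℝ) (b : Fin d → ℝ) (c : ℝ) : State d :=
  Fin.cons a (Fin.snoc b c : Fin (d + 1) → ℝ)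

/-- First entry. -/
def fst (u : State d) : ℝ := u 0

/-- Middle block. -/
def mid (u : State d) (j : Fin d) : ℝ := u j.castSucc.succ

/-- Last entry. -/
def lst (u : State d) : ℝ := u (Fin.last (d + 1))

@[simp] theorem fst_mk (a : ℝ) (b : Fin d → ℝ) (c : ℝ) : (mk a b c).fst = a := rfl

@[simp] theorem mid_mk (a : ℝ) (b : Fin d → ℝ) (c : ℝ) : (mk a b c).mid = b := by
  funext j
  simp [mid, mk]

@[simp] theorem lst_mk (a : ℝ) (b : Fin d → ℝ) (c : ℝ) : (mk a b c).lst = c := by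
  simp only [lst, mk, ← Fin.succ_last, Fin.cons_succ, Fin.snoc_last]

theorem mk_eta (u : State d) : mk u.fst u.mid u.lst = u := by
  funext i
  refine Fin.cases rfl (fun k => ?_) i
  refine Fin.lastCases ?_ (fun j => ?_) k
  · simp only [lst, mk, ← Fin.succ_last, Fin.cons_succ, Fin.snoc_last]
  · simp [mid, mk]

end State

/-! ### The compressible Euler equations of a perfect gas with ratio of specific heats `γ` -/

section Euler

variable {d : ℕ} (γ : ℝ)

/-- Velocity `V` of a conservative state `u = (ρ, ρV, ρE)`. -/
noncomputable def velocity (u : State d) (j : Fin d) : ℝ := u.mid j / u.fst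

/-- Pressure `P = (γ - 1) (ρE - ρ |V|² / 2)` of a conservative state. -/
noncomputable def pressure (u : State d) : ℝ :=
  (γ - 1) * (u.lst - u.fst * (∑ j, velocity u j ^ 2) / 2)

/-- Conservative states with positive density and pressure. -/
def PhysicalState (u : State d) : Prop := 0 < u.fst ∧ 0 < pressure γ u

/-- Specific entropy `s = log (P / ρ ^ γ)`. -/
noncomputable def specificEntropy (u : State d) : ℝ := Real.log (pressure γ u / u.fst ^ γ)

/-- Generalized entropy `H = - ρ s / (γ - 1)`. -/
noncomputable def genEntropy (u : State d) : ℝ := -(u.fst * specificEntropy γ u) / (γ - 1)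

/-- Entropy flux belonging to `genEntropy`: `𝓕 = H V = - ρ s V / (γ - 1)`. -/
noncomputable def entropyFlux (u : State d) (j : Fin d) : ℝ :=
  -(u.fst * specificEntropy γ u * velocity u j) / (γ - 1)

/-- The `j`-th column of the inviscid flux
`F(u) = (ρ V, ρ V ⊗ V + P I, ρ V (E + P / ρ))`. -/
noncomputable def flux (u : State d) (j : Fin d) : State d :=
  State.mk (u.fst * velocity u j)
    (fun k => u.fst * velocity u k * velocity u j + if k = j then pressure γ u else 0)
    ((u.lst + pressure γ u) * velocity u j)

/-- Entropy variables
`v(u) = ∂H/∂u = ((γ - s) / (γ - 1) - β |V|² / 2, β V, - β)`, where `β = ρ / P`. -/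
noncomputable def entropyVars (u : State d) : State d :=
  State.mk
    ((γ - specificEntropy γ u) / (γ - 1)
      - u.fst / pressure γ u * (∑ j, velocity u j ^ 2) / 2)
    (fun j => u.fst / pressure γ u * velocity u j)
    (-(u.fst / pressure γ u))

/-- Entropy variables of physical states: those with `- β < 0`. -/
def Admissible (v : State d) : Prop := v.lst < 0

/-- Pressure as a function of the entropy variables. -/
noncomputable def pressureOfVars (v : State d) : ℝ :=
  Real.exp (-((γ - (γ - 1) * (v.fst + (-v.lst) * (∑ j, (v.mid j / -v.lst) ^ 2) / 2))
    + γ * Real.log (-v.lst)) / (γ - 1))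

/-- Conservative variables `u(v)` as a function of the entropy variables: the inverse of
`entropyVars` (see `entropyVars_consVars` and `consVars_entropyVars`). -/
noncomputable def consVars (v : State d) : State d :=
  State.mk (-v.lst * pressureOfVars γ v)
    (fun j => -v.lst * pressureOfVars γ v * (v.mid j / -v.lst))
    (pressureOfVars γ v / (γ - 1)
      + -v.lst * pressureOfVars γ v * (∑ j, (v.mid j / -v.lst) ^ 2) / 2)

/-- Entropy potential `Ψ = ρ V`, as a function of the entropy variables. -/
noncomputable def potential (v : State d) (j : Fin d) : ℝ :=
  (consVars γ v).fst * velocity (consVars γ v) j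

variable {γ}

theorem velocity_consVars {v : State d} (hv : Admissible v) (j : Fin d) :
    velocity (consVars γ v) j = v.mid j / -v.lst := by
  have hP : 0 < pressureOfVars γ v := Real.exp_pos _
  have hb : 0 < -v.lst := neg_pos.mpr hv
  have h : -v.lst * pressureOfVars γ v ≠ 0 := (mul_pos hb hP).ne'
  simp only [velocity, consVars, State.fst_mk, State.mid_mk]
  exact mul_div_cancel_left₀ _ h

theorem pressure_consVars (hγ : 1 < γ) {v : State d} (hv : Admissible v) :
    pressure γ (consVars γ v) = pressureOfVars γ v := by
  have h : γ - 1 ≠ 0 := by linarith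
  simp only [pressure, velocity_consVars hv]
  simp only [consVars, State.fst_mk, State.lst_mk]
  field_simp
  ring

theorem physicalState_consVars (hγ : 1 < γ) {v : State d} (hv : Admissible v) :
    PhysicalState γ (consVars γ v) := by
  have hP : 0 < pressureOfVars γ v := Real.exp_pos _
  refine ⟨?_, by rw [pressure_consVars hγ hv]; exact hP⟩
  simp only [consVars, State.fst_mk]
  exact mul_pos (neg_pos.mpr hv) hP

theorem entropyVars_consVars (hγ : 1 < γ) {v : State d} (hv : Admissible v) :
    entropyVars γ (consVars γ v) = v := by
  have hP : 0 < pressureOfVars γ v := Real.exp_pos _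
  have hb : 0 < -v.lst := neg_pos.mpr hv
  have h : γ - 1 ≠ 0 := by linarith
  have hr : (consVars γ v).fst = -v.lst * pressureOfVars γ v := by simp [consVars]
  have hs : specificEntropy γ (consVars γ v)
      = γ - (γ - 1) * (v.fst + (-v.lst) * (∑ j, (v.mid j / -v.lst) ^ 2) / 2) := by
    have hlog : Real.log (pressureOfVars γ v) =
        -((γ - (γ - 1) * (v.fst + (-v.lst) * (∑ j, (v.mid j / -v.lst) ^ 2) / 2))
          + γ * Real.log (-v.lst)) / (γ - 1) := Real.log_exp _
    rw [specificEntropy, pressure_consVars hγ hv, hr,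
      Real.log_div hP.ne' (Real.rpow_pos_of_pos (mul_pos hb hP) γ).ne',
      Real.log_rpow (mul_pos hb hP), Real.log_mul hb.ne' hP.ne', hlog]
    field_simp
    ring
  have hq : (consVars γ v).fst / pressure γ (consVars γ v) = -v.lst := by
    rw [pressure_consVars hγ hv, hr, mul_div_cancel_right₀ _ hP.ne']
  conv_rhs => rw [← State.mk_eta v]
  rw [entropyVars, hq, hs]
  simp only [velocity_consVars hv]
  congr 1
  · field_simp
    ring
  · funext j
    exact mul_div_cancel₀ _ hb.ne'
  · ring

theorem consVars_entropyVars (hγ : 1 < γ) {u : State d} (hu : PhysicalState γ u) :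
    consVars γ (entropyVars γ u) = u := by
  obtain ⟨hr, hP⟩ := hu
  have h : γ - 1 ≠ 0 := by linarith
  have hb : 0 < u.fst / pressure γ u := div_pos hr hP
  have hV : ∀ j, (entropyVars γ u).mid j / -(entropyVars γ u).lst = velocity u j := by
    intro j
    simp only [entropyVars, State.mid_mk, State.lst_mk, neg_neg]
    exact mul_div_cancel_left₀ _ hb.ne'
  have hl : -(entropyVars γ u).lst = u.fst / pressure γ u := by simp [entropyVars]
  have hPv : pressureOfVars γ (entropyVars γ u) = pressure γ u := by
    rw [pressureOfVars]
    simp only [hV]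
    simp only [hl]
    rw [Real.log_div hr.ne' hP.ne', ← Real.exp_log hP]
    congr 1
    simp only [Real.exp_log hP, entropyVars, State.fst_mk, specificEntropy]
    rw [Real.log_div hP.ne' (Real.rpow_pos_of_pos hr γ).ne', Real.log_rpow hr]
    field_simp
    ring
  rw [consVars]
  simp only [hV]
  simp only [hl, hPv]
  conv_rhs => rw [← State.mk_eta u]
  have hm : u.fst / pressure γ u * pressure γ u = u.fst := div_mul_cancel₀ _ hP.ne'
  rw [hm]
  congr 1
  · funext j
    exact mul_div_cancel₀ _ hr.ne'
  · rw [pressure]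
    field_simp
    ring

end Euler

/-! ### Macro-element meshes -/

/-- Two simplices are face-to-face: they meet in a common face (possibly empty). -/
def FaceToFace {d : ℕ} (S S' : Affine.Simplex ℝ (Pt d) d) : Prop :=
  S.closedInterior ∩ S'.closedInterior = convexHull ℝ (range S.points ∩ range S'.points)

/-- A conforming simplicial mesh with elements indexed by `τ`, whose elements are grouped into
macro-elements indexed by `ι`. Any grouping of the elements is allowed. -/
structure MacroMesh (d : ℕ) (τ ι : Type*) where
  /-- The (nondegenerate, closed) simplicial elements. -/
  elem : τ → Affine.Simplex ℝ (Pt d) d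
  /-- The macro-element to which an element belongs. -/
  mac : τ → ι
  /-- Distinct elements have disjoint interiors. -/
  disjoint : ∀ a b, a ≠ b → Disjoint (elem a).interior (elem b).interior
  /-- Distinct elements are face-to-face. -/
  conforming : ∀ a b, a ≠ b → FaceToFace (elem a) (elem b)

namespace MacroMesh

variable {d : ℕ} {τ ι : Type*} (𝓣 : MacroMesh d τ ι)

/-- A closed element. -/
def cell (a : τ) : Set (Pt d) := (𝓣.elem a).closedInterior

/-- The closed macro-element `K`: the union of its elements. -/
def macroCell (K : ι) : Set (Pt d) := ⋃ a ∈ {a | 𝓣.mac a = K}, 𝓣.cell a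

/-- The closed domain `Ω ∪ ∂Ω` that the mesh covers. -/
def closedDomain : Set (Pt d) := ⋃ a, 𝓣.cell a

variable [NeZero d]

/-- The closed facet of element `a` opposite to its vertex `i`. -/
def facet (a : τ) (i : Fin (d + 1)) : Set (Pt d) := ((𝓣.elem a).faceOpposite i).closedInterior

/-- Unit normal of `facet a i` that points out of the element `a`: the normalized vector
from the vertex `i` to the foot of its altitude. -/
noncomputable def normal (a : τ) (i : Fin (d + 1)) : Pt d :=
  ((𝓣.elem a).height i)⁻¹ • ((𝓣.elem a).altitudeFoot i -ᵥ (𝓣.elem a).points i)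

/-- The facet lies on the boundary of the macro-element of `a`. -/
def OnMacroBoundary (a : τ) (i : Fin (d + 1)) : Prop :=
  𝓣.facet a i ⊆ frontier (𝓣.macroCell (𝓣.mac a))

/-- The facet lies on the boundary `∂Ω` of the domain. -/
def OnBoundary (a : τ) (i : Fin (d + 1)) : Prop :=
  𝓣.facet a i ⊆ frontier 𝓣.closedDomain

/-- The set `ε_h` of faces that carry the trace variable: the facets on macro-element
boundaries. A facet common to two elements occurs only once. -/
def faces : Set (Set (Pt d)) := {e | ∃ a i, 𝓣.OnMacroBoundary a i ∧ e = 𝓣.facet a i}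

end MacroMesh

/-! ### Finite element spaces -/

/-- On the set `D` the function `f` is a polynomial of total degree at most `p`. -/
def PolyOn {d : ℕ} (p : ℕ) (D : Set (Pt d)) (f : Pt d → ℝ) : Prop :=
  ∃ q : MvPolynomial (Fin d) ℝ, q.totalDegree ≤ p ∧
    ∀ x ∈ D, f x = MvPolynomial.eval (fun j => x j) q

/-- Vector fields given macro-element by macro-element; `w K` matters on the closed
macro-element `K` only. -/
abbrev VolFun (d : ℕ) (ι : Type*) := ι → Pt d → State d

/-- Vector fields given face by face; `μ e` matters on the face `e` only. -/
abbrev TraceFun (d : ℕ) := Set (Pt d) → Pt d → State d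

section Spaces

variable {d : ℕ} {τ ι : Type*} (𝓣 : MacroMesh d τ ι)

/-- The space `𝓥_h`: continuous on each macro-element, polynomial of degree at most `p` on each
element, no continuity between macro-elements. -/
def MacroMesh.volSpace (p : ℕ) : Set (VolFun d ι) :=
  {w | (∀ K, ContinuousOn (w K) (𝓣.macroCell K)) ∧
    ∀ a k, PolyOn p (𝓣.cell a) (fun x => w (𝓣.mac a) x k)}

/-- The space `𝓜_h`: polynomial of degree at most `p` on each face of the skeleton. -/
def MacroMesh.traceSpace [NeZero d] (p : ℕ) : Set (TraceFun d) :=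
  {μ | ∀ e ∈ 𝓣.faces, ∀ k, PolyOn p e (fun x => μ e x k)}

end Spaces

/-! ### Integrals over the mesh -/

section Integrals

variable {d : ℕ} {τ ι : Type*} [Fintype τ] (𝓣 : MacroMesh d τ ι)

/-- `∫_{𝓣_h} g`, the sum of the integrals over the elements. -/
noncomputable def MacroMesh.volInt (g : τ → Pt d → ℝ) : ℝ :=
  ∑ a, ∫ x in 𝓣.cell a, g a x

variable [NeZero d]

open Classical in
/-- Sum of the surface integrals over those facets of elements that satisfy `S`; an integrand may
take different values on the two sides of a face. -/
noncomputable def MacroMesh.facetInt (S : τ → Fin (d + 1) → Prop)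
    (g : τ → Fin (d + 1) → Pt d → ℝ) : ℝ :=
  ∑ a, ∑ i, if S a i then ∫ x in 𝓣.facet a i, g a i x ∂μHE[d - 1] else 0

/-- `∫_{∂𝓣_h} g`, the sum of the integrals over the boundaries of the macro-elements. -/
noncomputable def MacroMesh.skelInt (g : τ → Fin (d + 1) → Pt d → ℝ) : ℝ :=
  𝓣.facetInt 𝓣.OnMacroBoundary g

/-- `∫_{∂𝓣_h \ ∂Ω} g`. -/
noncomputable def MacroMesh.skelIntInterior (g : τ → Fin (d + 1) → Pt d → ℝ) : ℝ :=
  𝓣.facetInt (fun a i => 𝓣.OnMacroBoundary a i ∧ ¬ 𝓣.OnBoundary a i) g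

/-- `∫_{∂Ω} g`. -/
noncomputable def MacroMesh.bdryInt (g : τ → Fin (d + 1) → Pt d → ℝ) : ℝ :=
  𝓣.facetInt 𝓣.OnBoundary g

end Integrals

/-! ### The semi-discretization -/

/-- Inviscid numerical flux `F̂(v̂, v; n)`. -/
abbrev NumFlux (d : ℕ) := State d → State d → Pt d → State d

/-- Boundary trace operator `B̂(v̂, v; v^∂Ω, n)`, where `v^∂Ω` is the boundary datum. -/
abbrev BdryOp (d : ℕ) := State d → State d → State d → Pt d → State d

section Scheme

variable {d : ℕ} [NeZero d] {τ ι : Type*} (𝓣 : MacroMesh d τ ι) (γ : ℝ)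
  (Fhat : NumFlux d) (Bhat : BdryOp d)

/-- Numerical flux along the facet `(a, i)`, seen from the element `a`. -/
noncomputable def fluxAt (v : VolFun d ι) (vh : TraceFun d) (a : τ) (i : Fin (d + 1)) (x : Pt d) : State d :=
  Fhat (vh (𝓣.facet a i) x) (v (𝓣.mac a) x) (𝓣.normal a i)

/-- Boundary operator along the facet `(a, i)`, with boundary datum `vb`. -/
noncomputable def bdryAt (v : VolFun d ι) (vh : TraceFun d) (vb : Pt d → State d)
    (a : τ) (i : Fin (d + 1)) (x : Pt d) : State d :=
  Bhat (vh (𝓣.facet a i) x) (v (𝓣.mac a) x) (vb x) (𝓣.normal a i)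

/-- `(F(v), ∇w)` at a point of the element `a`: the sum of `F_{kj} ∂_j w_k`. -/
noncomputable def fluxGrad (v w : VolFun d ι) (a : τ) (x : Pt d) : ℝ :=
  ∑ j, flux γ (consVars γ (v (𝓣.mac a) x)) j ⬝ᵥ
    fderiv ℝ (w (𝓣.mac a)) x (EuclideanSpace.single j 1)

/-- `(v, v̂)` solves on `[0, T]` the macro-element entropy-variable HDG semi-discretization of the
compressible Euler equations, with polynomial degree `p`, trace space `Mh` and boundary
data `vb`. -/
structure IsSolution [Fintype τ] (p : ℕ) (Mh : Submodule ℝ (TraceFun d)) (T : ℝ)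
    (vb : ℝ → Pt d → State d) (v : ℝ → VolFun d ι) (vh : ℝ → TraceFun d) : Prop where
  /-- `v(t)` belongs to the finite element space. -/
  mem_vol : ∀ t ∈ Icc 0 T, v t ∈ 𝓣.volSpace p
  /-- `v̂(t)` belongs to the trace space. -/
  mem_trace : ∀ t ∈ Icc 0 T, vh t ∈ Mh
  /-- `v` is differentiable in time. -/
  diff : ∀ a, ∀ x ∈ 𝓣.cell a, DifferentiableOn ℝ (fun s => v s (𝓣.mac a) x) (Icc 0 T)
  /-- `v` takes physical values. -/
  adm_vol : ∀ t ∈ Icc 0 T, ∀ a, ∀ x ∈ 𝓣.cell a, Admissible (v t (𝓣.mac a) x)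
  /-- `v̂` takes physical values. -/
  adm_trace : ∀ t ∈ Icc 0 T, ∀ e ∈ 𝓣.faces, ∀ x ∈ e, Admissible (vh t e x)
  /-- The surface integrals of the numerical flux exist. -/
  int_flux : ∀ t ∈ Icc 0 T, ∀ a i, 𝓣.OnMacroBoundary a i →
    IntegrableOn (fluxAt 𝓣 Fhat (v t) (vh t) a i) (𝓣.facet a i) μHE[d - 1]
  /-- The surface integrals of the boundary operator exist. -/
  int_bdry : ∀ t ∈ Icc 0 T, ∀ a i, 𝓣.OnBoundary a i →
    IntegrableOn (bdryAt 𝓣 Bhat (v t) (vh t) (vb t) a i) (𝓣.facet a i) μHE[d - 1]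
  /-- `(∂u(v)/∂t, w) - (F(v), ∇w) + ⟨F̂, w⟩ = 0` for all test functions `w`. -/
  local_eq : ∀ t ∈ Icc 0 T, ∀ w ∈ 𝓣.volSpace p,
    𝓣.volInt (fun a x =>
        derivWithin (fun s => consVars γ (v s (𝓣.mac a) x)) (Icc 0 T) t ⬝ᵥ w (𝓣.mac a) x)
      - 𝓣.volInt (fluxGrad 𝓣 γ (v t) w)
      + 𝓣.skelInt (fun a i x => fluxAt 𝓣 Fhat (v t) (vh t) a i x ⬝ᵥ w (𝓣.mac a) x) = 0
  /-- `⟨F̂, μ⟩ + ⟨B̂, μ⟩ = 0` (on `∂𝓣_h \ ∂Ω` and `∂Ω`) for all trace test functions `μ`. -/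
  trace_eq : ∀ t ∈ Icc 0 T, ∀ μ ∈ Mh,
    𝓣.skelIntInterior (fun a i x => fluxAt 𝓣 Fhat (v t) (vh t) a i x ⬝ᵥ μ (𝓣.facet a i) x)
      + 𝓣.bdryInt (fun a i x =>
          bdryAt 𝓣 Bhat (v t) (vh t) (vb t) a i x ⬝ᵥ μ (𝓣.facet a i) x) = 0

/-- `∫_{𝓣_h} H(u(v))`. -/
noncomputable def totalEntropy [Fintype τ] (v : VolFun d ι) : ℝ :=
  𝓣.volInt (fun a x => genEntropy γ (consVars γ (v (𝓣.mac a) x)))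

/-- `∫_{∂𝓣_h} (⟦v⟧ᵀ F̂ - ⟦Ψ_n⟧)` with the jump `⟦a⟧ = â - a`. -/
noncomputable def entropyProduction [Fintype τ] (v : VolFun d ι) (vh : TraceFun d) : ℝ :=
  𝓣.skelInt (fun a i x =>
    (vh (𝓣.facet a i) x - v (𝓣.mac a) x) ⬝ᵥ fluxAt 𝓣 Fhat v vh a i x
      - (∑ j, potential γ (vh (𝓣.facet a i) x) j * 𝓣.normal a i j
          - ∑ j, potential γ (v (𝓣.mac a) x) j * 𝓣.normal a i j))

/-- The boundary term
`B_∂Ω = ∫_{∂Ω} 𝓕_n(v̂) - ∫_{∂Ω} v̂ᵀ F_n(v̂) + ∫_{∂Ω} v̂ᵀ (F̂ - B̂)`. -/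
noncomputable def bdryTerm [Fintype τ] (v : VolFun d ι) (vh : TraceFun d)
    (vb : Pt d → State d) : ℝ :=
  𝓣.bdryInt (fun a i x =>
      ∑ j, entropyFlux γ (consVars γ (vh (𝓣.facet a i) x)) j * 𝓣.normal a i j)
    - 𝓣.bdryInt (fun a i x =>
      vh (𝓣.facet a i) x ⬝ᵥ
        ∑ j, 𝓣.normal a i j • flux γ (consVars γ (vh (𝓣.facet a i) x)) j)
    + 𝓣.bdryInt (fun a i x =>
      vh (𝓣.facet a i) x ⬝ᵥ
        (fluxAt 𝓣 Fhat v vh a i x - bdryAt 𝓣 Bhat v vh vb a i x))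

end Scheme

end HDG

/-! The identity is the energy method in entropy variables: the semi-discretization is tested with
its own solution, `w = v` and `μ = v̂`. Two gradient relations turn the volume terms into exact
derivatives. The entropy variables are the gradient of `H` in the conservative variables, so `∂u/∂t
· v = ∂H/∂t` (`fderiv_genEntropy`). The gradient of `Ψ_j` in the entropy variables is `F_j`, so `∑
F_j · ∂_j v = div Ψ(v)` (`fderiv_potential`). The divergence theorem leaves `Ψ_n(v)` on the facets
of the elements; inside a macro-element the two sides of a facet cancel
(`MacroMesh.sum_facets_eq_skelInt`).

The trace equation replaces the integral of `F̂ · v̂` over the skeleton by that of `(F̂ - B̂) · v̂`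
over `∂Ω`. As `v̂` is single-valued, `Ψ_n(v̂)` cancels on interior faces
(`MacroMesh.skelIntInterior_normal_eq_zero`); what survives on `∂Ω` equals `v̂ᵀ F_n - 𝓕_n` by
`potential_eq`. The rest is linear bookkeeping (`IsSolution.entropy_identity`).

Three ingredients need work. The divergence theorem on a simplex (`setIntegral_fderiv_simplex`)
comes from Fubini's theorem along an edge, the edges at a vertex spanning all directions.
Cancellation needs that a facet off the boundary is shared by exactly two elements with opposite
normals (`MacroMesh.exists_facet_eq`, `MacroMesh.normal_eq_neg`, `MacroMesh.eq_of_facet_eq`).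
Finally, `v` is only pointwise differentiable in time; being polynomial of bounded degree on an
element, it depends linearly on finitely many of its values (`PolyOn.exists_interpolation`), which
justifies differentiation under the integral. -/

namespace HDG

open scoped RealInnerProductSpace
open Filter Topology

/-! ### Barycentric coordinates, heights and normals of a simplex. -/

section Simplex

variable {d : ℕ} (S : Affine.Simplex ℝ (Pt d) d)

/-- The vertices of a full-dimensional simplex as an affine basis; its coordinates are the
barycentric coordinates of the simplex. -/
noncomputable def bary : AffineBasis (Fin (d + 1)) ℝ (Pt d) :=
  ⟨S.points, S.independent, S.span_eq_top (by simp)⟩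

theorem continuous_coord (i : Fin (d + 1)) : Continuous ((bary S).coord i) :=
  continuous_barycentric_coord _ _

theorem closedInterior_eq_convexHull_bary : S.closedInterior = convexHull ℝ (range (bary S)) :=
  S.convexHull_eq_closedInterior.symm

theorem mem_closedInterior_iff {x : Pt d} :
    x ∈ S.closedInterior ↔ ∀ i, 0 ≤ (bary S).coord i x := by
  rw [closedInterior_eq_convexHull_bary, (bary S).convexHull_eq_nonneg_coord]
  rfl

theorem interior_closedInterior :
    interior S.closedInterior = {x | ∀ i, 0 < (bary S).coord i x} := by
  rw [closedInterior_eq_convexHull_bary, (bary S).interior_convexHull]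

theorem isCompact_closedInterior {m : ℕ} (S : Affine.Simplex ℝ (Pt d) m) :
    IsCompact S.closedInterior := by
  rw [← Affine.Simplex.convexHull_eq_closedInterior (𝕜 := ℝ) S]
  exact (finite_range S.points).isCompact_convexHull ℝ

theorem convex_closedInterior {m : ℕ} (S : Affine.Simplex ℝ (Pt d) m) :
    Convex ℝ S.closedInterior := by
  rw [← Affine.Simplex.convexHull_eq_closedInterior (𝕜 := ℝ) S]
  exact convex_convexHull _ _

theorem affineCombination_coord (x : Pt d) :
    Finset.univ.affineCombination ℝ S.points (fun i => (bary S).coord i x) = x :=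
  (bary S).affineCombination_coord_eq_self x

theorem coord_points (i j : Fin (d + 1)) :
    (bary S).coord i (S.points j) = if i = j then 1 else 0 :=
  (bary S).coord_apply i j

theorem exists_forall_coord_eq {w : Fin (d + 1) → ℝ} (hw : ∑ i, w i = 1) :
    ∃ x, ∀ i, (bary S).coord i x = w i :=
  ⟨Finset.univ.affineCombination ℝ (bary S) w, fun i =>
    (bary S).coord_apply_combination_of_mem (Finset.mem_univ i) hw⟩

/-- The edges issuing from a vertex span the space. -/
theorem span_edges (i : Fin (d + 1)) :
    Submodule.span ℝ (range fun k => S.points k - S.points i) = ⊤ := by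
  have h := (bary S).tot
  have h2 : vectorSpan ℝ (range (bary S)) = ⊤ := by
    rw [← direction_affineSpan, h, AffineSubspace.direction_top]
  rw [vectorSpan_range_eq_span_range_vsub_right ℝ _ i] at h2
  exact h2

variable [NeZero d]

theorem simplex_interior_eq : S.interior = interior S.closedInterior := by
  rw [interior_closedInterior]
  ext x
  conv_lhs => rw [← affineCombination_coord S x]
  rw [Affine.Simplex.affineCombination_mem_interior_iff ((bary S).sum_coord_apply_eq_one x)]
  refine ⟨fun h i => (h i).1, fun h i => ⟨h i, ?_⟩⟩
  rw [← (bary S).sum_coord_apply_eq_one x]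
  -- The bound `< 1` follows from the unit sum once some other coordinate is positive; such a
  -- coordinate exists because `d ≥ 1`.
  have hd := NeZero.ne d
  obtain ⟨j, hj⟩ : ∃ j : Fin (d + 1), j ≠ i := by
    have : Nontrivial (Fin (d + 1)) := Fin.nontrivial_iff_two_le.2 (by omega)
    exact exists_ne i
  exact Finset.single_lt_sum hj (Finset.mem_univ i) (Finset.mem_univ j) (h j)
    (fun k _ _ => (h k).le)

theorem mem_faceOpposite_iff (k : Fin (d + 1)) {x : Pt d} :
    x ∈ (S.faceOpposite k).closedInterior ↔
      (bary S).coord k x = 0 ∧ ∀ i, 0 ≤ (bary S).coord i x := by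
  conv_lhs => rw [← affineCombination_coord S x]
  rw [Affine.Simplex.faceOpposite,
    Affine.Simplex.affineCombination_mem_closedInterior_face_iff_nonneg _ _
      ((bary S).sum_coord_apply_eq_one x)]
  constructor
  · rintro ⟨h1, h2⟩
    have h0 : (bary S).coord k x = 0 := h2 k (by simp)
    refine ⟨h0, fun i => ?_⟩
    by_cases hi : i = k
    · rw [hi, h0]
    · exact h1 i (by simpa using hi)
  · rintro ⟨h1, h2⟩
    refine ⟨fun i _ => h2 i, fun i hi => ?_⟩
    have : i = k := by simpa using hi
    rw [this, h1]

/-- Unit normal of the facet opposite to the vertex `k`, pointing out of the simplex. -/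
noncomputable def outNormal (k : Fin (d + 1)) : Pt d :=
  (S.height k)⁻¹ • (S.altitudeFoot k -ᵥ S.points k)

theorem norm_outNormal (k : Fin (d + 1)) : ‖outNormal S k‖ = 1 := by
  have h := S.height_pos k
  rw [outNormal, norm_smul, Real.norm_of_nonneg (inv_pos.2 h).le, ← dist_eq_norm_vsub,
    dist_comm]
  exact inv_mul_cancel₀ h.ne'

theorem inner_outNormal_of_mem_direction (k : Fin (d + 1)) {v : Pt d}
    (hv : v ∈ (affineSpan ℝ (S.points '' {k}ᶜ)).direction) : ⟪outNormal S k, v⟫ = 0 := by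
  have h : S.points k -ᵥ S.altitudeFoot k ∈ (affineSpan ℝ (S.points '' {k}ᶜ)).directionᗮ := by
    rw [Affine.Simplex.altitudeFoot, Affine.Simplex.orthogonalProjectionSpan]
    simp_rw [Affine.Simplex.range_faceOpposite_points]
    exact EuclideanGeometry.vsub_orthogonalProjection_mem_direction_orthogonal _ _
  have h2 := Submodule.inner_left_of_mem_orthogonal hv h
  rw [outNormal, ← neg_vsub_eq_vsub_rev, inner_smul_left, inner_neg_left, h2]
  simp

/-- Split the edge at the foot of the altitude: one part lies in the facet plane, the other is the
height times the normal. -/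
theorem inner_outNormal_points (k j : Fin (d + 1)) (hj : j ≠ k) :
    ⟪outNormal S k, S.points j - S.points k⟫ = S.height k := by
  have h0 : ⟪outNormal S k, S.points j -ᵥ S.altitudeFoot k⟫ = 0 :=
    inner_outNormal_of_mem_direction S k <| AffineSubspace.vsub_mem_direction
      (subset_affineSpan ℝ _ ⟨j, by simpa using hj, rfl⟩)
      (S.altitudeFoot_mem_affineSpan_image_compl k)
  have hh := S.height_pos k
  have h1 : S.points j - S.points k
      = (S.points j -ᵥ S.altitudeFoot k) + S.height k • outNormal S k := by
    rw [outNormal, smul_smul, mul_inv_cancel₀ hh.ne', one_smul]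
    simp
  rw [h1, inner_add_right, h0, inner_smul_right, real_inner_self_eq_norm_sq, norm_outNormal]
  ring

/-- Write `x - p_k` as a combination of the edges at `p_k`, weighted by the barycentric coordinates:
every nontrivial edge has the same inner product, the height, with the normal. -/
theorem coord_eq (k : Fin (d + 1)) (x : Pt d) :
    (bary S).coord k x = 1 - ⟪outNormal S k, x - S.points k⟫ / S.height k := by
  have hh := S.height_pos k
  have hx := affineCombination_coord S x
  have hs := (bary S).sum_coord_apply_eq_one x
  rw [Finset.affineCombination_eq_linear_combination _ _ _ hs] at hx
  have h1 : x - S.points k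
      = ∑ i, (bary S).coord i x • (S.points i - S.points k) := by
    simp_rw [smul_sub, Finset.sum_sub_distrib, hx, ← Finset.sum_smul, hs, one_smul]
  have h2 : ⟪outNormal S k, x - S.points k⟫
      = ∑ i, ((bary S).coord i x * S.height k - if i = k then (bary S).coord k x * S.height k else 0) := by
    rw [h1, inner_sum]
    refine Finset.sum_congr rfl fun i _ => ?_
    rw [inner_smul_right]
    by_cases hi : i = k
    · subst hi; simp
    · rw [inner_outNormal_points S k i hi]; simp [hi]
  rw [h2, Finset.sum_sub_distrib, ← Finset.sum_mul, hs]
  simp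
  field_simp
  ring

theorem coord_add (k : Fin (d + 1)) (x v : Pt d) :
    (bary S).coord k (x + v) = (bary S).coord k x - ⟪outNormal S k, v⟫ / S.height k := by
  rw [coord_eq, coord_eq, add_sub_right_comm, inner_add_right]
  ring

/-- The `m`-th coordinate has gradient `-n_m / h_m` and Kronecker values at the vertices. Hence an
edge is parallel to all facets but the two opposite to its endpoints, and only these two enter the
divergence theorem in an edge direction. -/
theorem inner_outNormal_edge (m i k : Fin (d + 1)) :
    ⟪outNormal S m, S.points k - S.points i⟫
      = (if m = i then S.height m else 0) - (if m = k then S.height m else 0) := by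
  have hh := S.height_pos m
  have h := coord_add S m (S.points i) (S.points k - S.points i)
  rw [add_sub_cancel, coord_points, coord_points] at h
  have h' : ⟪outNormal S m, S.points k - S.points i⟫
    = ((if m = i then 1 else 0) - (if m = k then 1 else 0)) * S.height m := by
    field_simp at h ⊢
    linarith
  rw [h']
  split_ifs <;> ring

/-- The hyperplane through a facet. -/
theorem coord_eq_zero_iff (k j : Fin (d + 1)) (hj : j ≠ k) (x : Pt d) :
    (bary S).coord k x = 0 ↔ ⟪outNormal S k, x - S.points j⟫ = 0 := by
  have hh := S.height_pos k
  have h := coord_add S k (S.points j) (x - S.points j)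
  rw [add_sub_cancel, coord_points, if_neg (Ne.symm hj)] at h
  rw [h]
  simp [hh.ne']

theorem exists_ne_fin (k : Fin (d + 1)) : ∃ j : Fin (d + 1), j ≠ k := by
  have hd := NeZero.ne d
  have : Nontrivial (Fin (d + 1)) := Fin.nontrivial_iff_two_le.2 (by omega)
  exact exists_ne k

end Simplex

/-! ### Fubini's theorem over a hyperplane with its Hausdorff measure. -/

section Slicing

variable {d : ℕ} {n w : Pt d}

/-- Oblique coordinates with respect to a hyperplane with unit normal `n` and a transversal
vector `w` preserve the volume as soon as `⟪n, w⟫ = 1`. -/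
theorem measurePreserving_oblique (q : Pt d) (hn : ‖n‖ = 1) (hw : ⟪n, w⟫ = 1) :
    MeasurePreserving (fun p : ℝ × (ℝ ∙ n)ᗮ => q + p.2 + p.1 • w) volume volume := by
  have hwn : w - n ∈ (ℝ ∙ n)ᗮ := by
    rw [Submodule.mem_orthogonal_singleton_iff_inner_right, inner_sub_right, hw,
      real_inner_self_eq_norm_sq, hn]
    norm_num
  have h1 := ((ℝ ∙ n).measurePreserving_measurableEquivProd q).symm
  rw [InnerProductSpace.euclideanHausdorffMeasure_eq_volume] at h1
  have h2 : MeasurePreserving (LinearIsometryEquiv.toSpanUnitSingleton (𝕜 := ℝ) n hn)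
      volume volume := LinearIsometryEquiv.measurePreserving _
  -- A shear: over each `t` the hyperplane is translated by `t • (w - n)`, which preserves its
  -- volume.
  have h3 : MeasurePreserving
      (fun p : ℝ × (ℝ ∙ n)ᗮ => (LinearIsometryEquiv.toSpanUnitSingleton (𝕜 := ℝ) n hn p.1,
        p.1 • (⟨w - n, hwn⟩ : (ℝ ∙ n)ᗮ) + p.2))
      (volume.prod volume) (volume.prod volume) := by
    refine h2.skew_product (g := fun t y => t • (⟨w - n, hwn⟩ : (ℝ ∙ n)ᗮ) + y) ?_ ?_
    · fun_prop
    · exact ae_of_all _ fun t => map_add_left_eq_self _ _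
  have h4 := h1.comp h3
  have h5 : (fun p : ℝ × (ℝ ∙ n)ᗮ => q + p.2 + p.1 • w)
      = ((ℝ ∙ n).measurableEquivProd q).symm ∘
        (fun p : ℝ × (ℝ ∙ n)ᗮ => (LinearIsometryEquiv.toSpanUnitSingleton (𝕜 := ℝ) n hn p.1,
        p.1 • (⟨w - n, hwn⟩ : (ℝ ∙ n)ᗮ) + p.2)) := by
    funext p
    simp [smul_sub]
    abel
  rw [h5]
  exact h4

theorem finrank_orthogonal_unit (hn : ‖n‖ = 1) : Module.finrank ℝ (ℝ ∙ n)ᗮ = d - 1 := by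
  have h0 : n ≠ 0 := by
    rintro rfl
    simp at hn
  have h := (ℝ ∙ n).finrank_add_finrank_orthogonal
  rw [finrank_span_singleton h0, finrank_euclideanSpace_fin] at h
  omega

theorem isometry_add_orthogonal (q : Pt d) :
    Isometry fun y : (ℝ ∙ n)ᗮ => q + (y : Pt d) :=
  (IsometryEquiv.addLeft q).isometry.comp isometry_subtype_coe

theorem measurableEmbedding_add_orthogonal (q : Pt d) :
    MeasurableEmbedding fun y : (ℝ ∙ n)ᗮ => q + (y : Pt d) :=
  (isometry_add_orthogonal q).isClosedEmbedding.measurableEmbedding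

theorem range_add_orthogonal (q : Pt d) :
    range (fun y : (ℝ ∙ n)ᗮ => q + (y : Pt d)) = {x | ⟪n, x - q⟫ = 0} := by
  ext x
  constructor
  · rintro ⟨y, rfl⟩
    have := y.2
    rw [Submodule.mem_orthogonal_singleton_iff_inner_right] at this
    simpa using this
  · intro hx
    exact ⟨⟨x - q, by rw [Submodule.mem_orthogonal_singleton_iff_inner_right]; exact hx⟩, by simp⟩

/-- The volume of the `(d - 1)`-dimensional space `(ℝ ∙ n)ᗮ` is its normalized Hausdorff measure,
which isometries transport. This links surface integrals to Lebesgue integrals. -/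
theorem map_volume_add_orthogonal (q : Pt d) (hn : ‖n‖ = 1) :
    (volume : Measure (ℝ ∙ n)ᗮ).map (fun y : (ℝ ∙ n)ᗮ => q + (y : Pt d))
      = (μHE[d - 1] : Measure (Pt d)).restrict {x | ⟪n, x - q⟫ = 0} := by
  rw [← InnerProductSpace.euclideanHausdorffMeasure_eq_volume, finrank_orthogonal_unit hn,
    (isometry_add_orthogonal q).map_euclideanHausdorffMeasure, range_add_orthogonal]

theorem setIntegral_hyperplane (q : Pt d) (hn : ‖n‖ = 1) {F : Set (Pt d)} (hF : MeasurableSet F)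
    (hFq : ∀ x ∈ F, ⟪n, x - q⟫ = 0) (f : Pt d → ℝ) :
    ∫ x in F, f x ∂μHE[d - 1] = ∫ y : (ℝ ∙ n)ᗮ, F.indicator f (q + y) := by
  rw [← (measurableEmbedding_add_orthogonal q).integral_map, map_volume_add_orthogonal q hn,
    integral_indicator hF, Measure.restrict_restrict hF, inter_eq_left.2 (show F ⊆ {x | ⟪n, x - q⟫ = 0} from hFq)]

/-- The set pulls back to a compact set in a Euclidean space of dimension `d - 1`. Finiteness makes
continuous functions integrable on facets. -/
theorem euclideanHausdorffMeasure_lt_top_of_hyperplane (q : Pt d) (hn : ‖n‖ = 1)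
    {F : Set (Pt d)} (hF : IsCompact F) (hFq : ∀ x ∈ F, ⟪n, x - q⟫ = 0) :
    (μHE[d - 1] : Measure (Pt d)) F < ⊤ := by
  have h : (μHE[d - 1] : Measure (Pt d)) F
      = volume ((fun y : (ℝ ∙ n)ᗮ => q + (y : Pt d)) ⁻¹' F) := by
    rw [← (measurableEmbedding_add_orthogonal q).map_apply, map_volume_add_orthogonal q hn,
      Measure.restrict_apply hF.measurableSet, inter_eq_left.2 (show F ⊆ {x | ⟪n, x - q⟫ = 0} from hFq)]
  rw [h]
  exact ((isometry_add_orthogonal q).isClosedEmbedding.isCompact_preimage hF).measure_lt_top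

/-- Fubini's theorem in oblique coordinates, for a set whose sections by the lines parallel to `w`
are segments issuing over a set `F` in a hyperplane. -/
theorem setIntegral_eq_integral_segments (q : Pt d) (hn : ‖n‖ = 1) (hw : ⟪n, w⟫ = 1)
    {A F : Set (Pt d)} (hA : MeasurableSet A) (hF : MeasurableSet F)
    (hFq : ∀ x ∈ F, ⟪n, x - q⟫ = 0) {α β : Pt d → ℝ}
    (hsec : ∀ y, ⟪n, y - q⟫ = 0 → ∀ t, y + t • w ∈ A ↔ y ∈ F ∧ t ∈ Icc (α y) (β y))
    (hle : ∀ y ∈ F, α y ≤ β y) {g : Pt d → ℝ} (hg : IntegrableOn g A) :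
    ∫ x in A, g x = ∫ y in F, (∫ t in α y..β y, g (y + t • w)) ∂μHE[d - 1] := by
  have hmp := measurePreserving_oblique q hn hw
  have hi : Integrable (A.indicator g) := (integrable_indicator_iff hA).2 hg
  have hi2 : Integrable (fun p : ℝ × (ℝ ∙ n)ᗮ => A.indicator g (q + p.2 + p.1 • w))
      (volume.prod volume) := hmp.integrable_comp_of_integrable hi
  rw [← integral_indicator hA, ← hmp.map_eq,
    integral_map hmp.measurable.aemeasurable (by rw [hmp.map_eq]; exact hi.aestronglyMeasurable),
    Measure.volume_eq_prod, integral_prod_symm _ hi2, setIntegral_hyperplane q hn hF hFq]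
  congr 1
  funext y
  have hy : ⟪n, (q + (y : Pt d)) - q⟫ = 0 := by
    have := y.2
    rw [Submodule.mem_orthogonal_singleton_iff_inner_right] at this
    simpa using this
  by_cases hyF : q + (y : Pt d) ∈ F
  · rw [indicator_of_mem hyF, intervalIntegral.integral_of_le (hle _ hyF),
      ← integral_Icc_eq_integral_Ioc, ← integral_indicator measurableSet_Icc]
    congr 1
    funext t
    by_cases ht : t ∈ Icc (α (q + (y : Pt d))) (β (q + y))
    · rw [indicator_of_mem ht, indicator_of_mem ((hsec _ hy t).2 ⟨hyF, ht⟩)]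
    · rw [indicator_of_notMem ht, indicator_of_notMem fun h => ht ((hsec _ hy t).1 h).2]
  · rw [indicator_of_notMem hyF]
    refine integral_eq_zero_of_ae (ae_of_all _ fun t => ?_)
    exact indicator_of_notMem (fun h => hyF ((hsec _ hy t).1 h).1) _

end Slicing

/-! ### The divergence theorem on a simplex. -/

section Divergence

variable {d : ℕ} [NeZero d] (S : Affine.Simplex ℝ (Pt d) d)

theorem coord_add_edge (i k m : Fin (d + 1)) (y : Pt d) (s : ℝ) :
    (bary S).coord m (y + s • (S.points k - S.points i))
      = (bary S).coord m y + s * ((if m = k then 1 else 0) - (if m = i then 1 else 0)) := by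
  have hh := S.height_pos m
  rw [coord_add, inner_smul_right, inner_outNormal_edge]
  split_ifs <;> field_simp <;> ring

theorem measurableSet_facet (k : Fin (d + 1)) :
    MeasurableSet (S.faceOpposite k).closedInterior :=
  (isCompact_closedInterior _).measurableSet

theorem euclideanHausdorffMeasure_facet_lt_top (k : Fin (d + 1)) :
    (μHE[d - 1] : Measure (Pt d)) (S.faceOpposite k).closedInterior < ⊤ := by
  obtain ⟨j, hj⟩ := exists_ne_fin k
  refine euclideanHausdorffMeasure_lt_top_of_hyperplane (S.points j) (norm_outNormal S k)
    (isCompact_closedInterior _) fun x hx => ?_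
  rw [← coord_eq_zero_iff S k j hj]
  exact ((mem_faceOpposite_iff S k).1 hx).1

theorem integrableOn_facet (k : Fin (d + 1)) {f : Pt d → ℝ}
    (hf : ContinuousOn f (S.faceOpposite k).closedInterior) :
    IntegrableOn f (S.faceOpposite k).closedInterior μHE[d - 1] :=
  hf.integrableOn_of_subset_isCompact (isCompact_closedInterior _) (measurableSet_facet S k)
    subset_rfl (euclideanHausdorffMeasure_facet_lt_top S k).ne

/-- Fubini's theorem with respect to a facet and an edge leading to the opposite vertex. -/
theorem setIntegral_eq_height_mul (k i : Fin (d + 1)) (hik : i ≠ k) {A F : Set (Pt d)}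
    (hA : MeasurableSet A) (hF : MeasurableSet F) (hFk : ∀ x ∈ F, (bary S).coord k x = 0)
    {α β : Pt d → ℝ}
    (hsec : ∀ y, (bary S).coord k y = 0 → ∀ s : ℝ,
      y + s • (S.points k - S.points i) ∈ A ↔ y ∈ F ∧ s ∈ Icc (α y) (β y))
    (hle : ∀ y ∈ F, α y ≤ β y) {g : Pt d → ℝ} (hg : IntegrableOn g A) :
    ∫ x in A, g x = S.height k *
      ∫ y in F, (∫ s in α y..β y, g (y + s • (S.points k - S.points i))) ∂μHE[d - 1] := by
  have hh := S.height_pos k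
  have hzero : ∀ x, ⟪-outNormal S k, x - S.points i⟫ = 0 ↔ (bary S).coord k x = 0 := by
    intro x
    rw [coord_eq_zero_iff S k i hik, inner_neg_left, neg_eq_zero]
  -- The normal of facet `k` is turned towards the vertex `k` and the edge is rescaled by the
  -- height, to meet the normalization `⟪n, w⟫ = 1`; undoing the rescaling in `s` produces the
  -- factor `S.height k`.
  have hw : ⟪-outNormal S k, (S.height k)⁻¹ • (S.points k - S.points i)⟫ = 1 := by
    rw [inner_neg_left, inner_smul_right, inner_outNormal_edge, if_neg (Ne.symm hik), if_pos rfl]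
    field_simp
    ring
  have hiff : ∀ a b t : ℝ, t ∈ Icc (S.height k * a) (S.height k * b)
      ↔ t * (S.height k)⁻¹ ∈ Icc a b := by
    intro a b t
    rw [mem_Icc, mem_Icc, ← div_eq_mul_inv, le_div_iff₀ hh, div_le_iff₀ hh, mul_comm a, mul_comm b]
  rw [setIntegral_eq_integral_segments (S.points i) (by rw [norm_neg, norm_outNormal]) hw hA hF
    (fun x hx => (hzero x).2 (hFk x hx)) (α := fun y => S.height k * α y)
    (β := fun y => S.height k * β y)
    (fun y hy t => by
      rw [smul_smul, hsec y ((hzero y).1 hy), hiff])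
    (fun y hy => mul_le_mul_of_nonneg_left (hle y hy) hh.le) hg, ← integral_const_mul]
  congr 1
  funext y
  have h := intervalIntegral.mul_integral_comp_mul_left
    (f := fun t => g (y + t • (S.height k)⁻¹ • (S.points k - S.points i)))
    (a := α y) (b := β y) (c := S.height k)
  rw [← h]
  congr 2
  funext s
  rw [smul_smul, mul_comm (S.height k), mul_assoc, mul_inv_cancel₀ hh.ne', mul_one]

/-- Moving by `s` along the edge from `i` to `k` transfers barycentric weight `s` from vertex `i` to
vertex `k`, so the line leaves the simplex exactly when the weight of `i` is used up. -/
theorem add_edge_mem_closedInterior_iff (k i : Fin (d + 1)) (hik : i ≠ k) {y : Pt d}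
    (hy : (bary S).coord k y = 0) (s : ℝ) :
    y + s • (S.points k - S.points i) ∈ S.closedInterior ↔
      y ∈ (S.faceOpposite k).closedInterior ∧ s ∈ Icc 0 ((bary S).coord i y) := by
  rw [mem_closedInterior_iff, mem_faceOpposite_iff]
  simp_rw [coord_add_edge]
  constructor
  · intro h
    have hk := h k
    have hi := h i
    rw [if_pos rfl, if_neg (Ne.symm hik), hy] at hk
    rw [if_pos rfl, if_neg hik] at hi
    refine ⟨⟨hy, fun m => ?_⟩, by linarith, by linarith⟩
    have hm := h m
    by_cases h1 : m = k
    · rw [h1, hy]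
    · by_cases h2 : m = i
      · rw [h2]; linarith
      · simpa [h1, h2] using hm
  · rintro ⟨⟨-, h⟩, h0, hs⟩ m
    have hm := h m
    by_cases h1 : m = k
    · subst h1; rw [if_pos rfl, if_neg (Ne.symm hik)]; linarith
    · by_cases h2 : m = i
      · subst h2; rw [if_pos rfl, if_neg h1]; linarith
      · simpa [h1, h2] using hm

theorem add_edge_mem_facet_iff (k i : Fin (d + 1)) (hik : i ≠ k) {y : Pt d}
    (hy : (bary S).coord k y = 0) :
    y + (bary S).coord i y • (S.points k - S.points i) ∈ (S.faceOpposite i).closedInterior ↔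
      y ∈ (S.faceOpposite k).closedInterior := by
  rw [mem_faceOpposite_iff, mem_faceOpposite_iff]
  simp_rw [coord_add_edge]
  simp only [if_neg hik, if_true]
  constructor
  · rintro ⟨-, h⟩
    refine ⟨hy, fun m => ?_⟩
    have hm := h m
    by_cases h1 : m = k
    · rw [h1, hy]
    · by_cases h2 : m = i
      · have hk := h k
        rw [if_pos rfl, if_neg (Ne.symm hik), hy] at hk
        rw [h2]; linarith
      · simpa [h1, h2] using hm
  · rintro ⟨-, h⟩
    refine ⟨by ring, fun m => ?_⟩
    have hm := h m
    by_cases h1 : m = k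
    · subst h1
      have hi := h i
      rw [if_pos rfl, if_neg (Ne.symm hik)]; linarith
    · by_cases h2 : m = i
      · subst h2; rw [if_pos rfl, if_neg h1]; linarith
      · simpa [h1, h2] using hm

omit [NeZero d] in
theorem continuous_add_coord_smul (i : Fin (d + 1)) (e : Pt d) :
    Continuous fun x : Pt d => x + (bary S).coord i x • e :=
  continuous_id.add ((continuous_coord S i).smul continuous_const)

/-- The measures of two facets of a simplex, weighted with the heights over them, correspond to
each other under the projection along the edge that joins the opposite vertices. -/
theorem height_mul_setIntegral_facet (k i : Fin (d + 1)) (hik : i ≠ k) {f : Pt d → ℝ}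
    (hf : ContinuousOn f (S.faceOpposite i).closedInterior) :
    S.height k * ∫ y in (S.faceOpposite k).closedInterior,
        f (y + (bary S).coord i y • (S.points k - S.points i)) ∂μHE[d - 1]
      = S.height i * ∫ y in (S.faceOpposite i).closedInterior, f y ∂μHE[d - 1] := by
  set e := S.points k - S.points i with he
  have hee : S.points i - S.points k = -e := by rw [he, neg_sub]
  -- A prism with generators parallel to `e`. Both sides are the integral over `P` of `f` composed
  -- with the projection along `e` onto the plane of facet `i`: sliced over either facet, the
  -- segments have unit parameter length and the integrand is constant on them.
  set P : Set (Pt d) := {x | x + (bary S).coord i x • e ∈ (S.faceOpposite i).closedInterior ∧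
    (bary S).coord i x ∈ Icc (0 : ℝ) 1} with hP
  have hcoord : ∀ (y : Pt d) (s : ℝ), (bary S).coord i (y + s • e) = (bary S).coord i y - s := by
    intro y s
    rw [he, coord_add_edge, if_neg hik, if_pos rfl]
    ring
  have hproj : ∀ (y : Pt d) (s : ℝ), y + s • e + (bary S).coord i (y + s • e) • e
      = y + (bary S).coord i y • e := by
    intro y s
    rw [hcoord, add_assoc, ← add_smul]
    congr 2
    ring
  have hPc : IsCompact P := by
    have h1 : P ⊆ (fun p : Pt d × ℝ => p.1 - p.2 • e) ''
        ((S.faceOpposite i).closedInterior ×ˢ Icc (0 : ℝ) 1) := by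
      rintro x ⟨hx1, hx2⟩
      exact ⟨(x + (bary S).coord i x • e, (bary S).coord i x), ⟨hx1, hx2⟩, by simp⟩
    have h2 : IsCompact ((fun p : Pt d × ℝ => p.1 - p.2 • e) ''
        ((S.faceOpposite i).closedInterior ×ˢ Icc (0 : ℝ) 1)) :=
      ((isCompact_closedInterior _).prod isCompact_Icc).image (by fun_prop)
    refine h2.of_isClosed_subset ?_ h1
    exact ((isCompact_closedInterior _).isClosed.preimage (continuous_add_coord_smul S i e)).inter
      (isClosed_Icc.preimage (continuous_coord S i))
  have hg : IntegrableOn (fun x => f (x + (bary S).coord i x • e)) P :=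
    ContinuousOn.integrableOn_compact hPc
      (hf.comp (continuous_add_coord_smul S i e).continuousOn fun x hx => hx.1)
  have h1 := setIntegral_eq_height_mul S k i hik hPc.measurableSet (measurableSet_facet S k)
    (fun x hx => ((mem_faceOpposite_iff S k).1 hx).1)
    (α := fun y => (bary S).coord i y - 1) (β := fun y => (bary S).coord i y)
    (fun y hy s => by
      rw [← he]
      change (_ ∧ _) ↔ _
      rw [hproj, hcoord, he, add_edge_mem_facet_iff S k i hik hy, mem_Icc, mem_Icc]
      constructor <;> rintro ⟨h, h', h''⟩ <;> refine ⟨h, ?_, ?_⟩ <;> linarith)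
    (fun y _ => by linarith) hg
  have h2 := setIntegral_eq_height_mul S i k (Ne.symm hik) hPc.measurableSet
    (measurableSet_facet S i)
    (fun x hx => ((mem_faceOpposite_iff S i).1 hx).1)
    (α := fun _ => 0) (β := fun _ => 1)
    (fun y hy s => by
      rw [hee, smul_neg, ← neg_smul]
      change (_ ∧ _) ↔ _
      rw [hproj, hcoord, hy, zero_smul, add_zero]
      simp)
    (fun y _ => by norm_num) hg
  rw [← he] at h1
  rw [hee] at h2
  simp_rw [hproj] at h1
  have h3 : ∀ (y : Pt d) (s : ℝ), y + s • -e + (bary S).coord i (y + s • -e) • e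
      = y + (bary S).coord i y • e := by
    intro y s
    rw [smul_neg, ← neg_smul, hproj]
  simp_rw [h3] at h2
  simp only [intervalIntegral.integral_const, sub_sub_cancel, one_smul] at h1
  rw [← h1, h2]
  congr 1
  refine setIntegral_congr_fun (measurableSet_facet S i) fun y hy => ?_
  have hy0 : (bary S).coord i y = 0 := ((mem_faceOpposite_iff S i).1 hy).1
  simp [hy0]

omit [NeZero d] in
theorem continuousOn_of_contDiffAt {f : Pt d → ℝ} {s : Set (Pt d)}
    (hf : ∀ x ∈ s, ContDiffAt ℝ 1 f x) : ContinuousOn f s :=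
  fun x hx => (hf x hx).continuousAt.continuousWithinAt

omit [NeZero d] in
theorem continuousOn_fderiv_of_contDiffAt {f : Pt d → ℝ} {s : Set (Pt d)}
    (hf : ∀ x ∈ s, ContDiffAt ℝ 1 f x) (v : Pt d) : ContinuousOn (fun x => fderiv ℝ f x v) s :=
  fun x hx => (((hf x hx).fderiv_right (m := 0) (by norm_num)).continuousAt.clm_apply
    continuousAt_const).continuousWithinAt

/-- The divergence theorem on a simplex for constant directions parallel to an edge. -/
theorem setIntegral_fderiv_edge (k i : Fin (d + 1)) (hik : i ≠ k) {f : Pt d → ℝ}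
    (hf : ∀ x ∈ S.closedInterior, ContDiffAt ℝ 1 f x) :
    ∫ x in S.closedInterior, fderiv ℝ f x (S.points k - S.points i)
      = S.height i * (∫ y in (S.faceOpposite i).closedInterior, f y ∂μHE[d - 1])
        - S.height k * (∫ y in (S.faceOpposite k).closedInterior, f y ∂μHE[d - 1]) := by
  have hS := isCompact_closedInterior S
  have hsub := fun m => S.closedInterior_faceOpposite_subset_closedInterior (k := ℝ) (i := m)
  have hfc := continuousOn_of_contDiffAt hf
  set e := S.points k - S.points i with he
  -- Both surface integrals are brought to facet `k`; there the integrand is the difference of the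
  -- endpoint values on a segment, which the fundamental theorem of calculus identifies.
  rw [← height_mul_setIntegral_facet S k i hik (hfc.mono (hsub i)), ← mul_sub, ← integral_sub,
    setIntegral_eq_height_mul S k i hik hS.measurableSet (measurableSet_facet S k)
      (fun x hx => ((mem_faceOpposite_iff S k).1 hx).1)
      (fun y hy s => add_edge_mem_closedInterior_iff S k i hik hy s)
      (fun y hy => ((mem_faceOpposite_iff S k).1 hy).2 i)
      ((continuousOn_fderiv_of_contDiffAt hf e).integrableOn_compact hS)]
  · congr 1
    refine setIntegral_congr_fun (measurableSet_facet S k) fun y hy => ?_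
    have hy' := (mem_faceOpposite_iff S k).1 hy
    have hmem : ∀ s ∈ uIcc 0 ((bary S).coord i y), y + s • e ∈ S.closedInterior := by
      intro s hs
      rw [uIcc_of_le (hy'.2 i)] at hs
      exact (add_edge_mem_closedInterior_iff S k i hik hy'.1 s).2 ⟨hy, hs⟩
    have hline : ∀ s : ℝ, HasDerivAt (fun s : ℝ => y + s • e) e s := by
      intro s
      simpa using ((hasDerivAt_id s).smul_const e).const_add y
    have := intervalIntegral.integral_eq_sub_of_hasDerivAt (a := 0) (b := (bary S).coord i y)
      (f := fun s => f (y + s • e)) (f' := fun s => fderiv ℝ f (y + s • e) e)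
      (fun s hs => ((hf _ (hmem s hs)).differentiableAt (by norm_num)).hasFDerivAt.comp_hasDerivAt
        s (hline s))
      (ContinuousOn.intervalIntegrable
        ((continuousOn_fderiv_of_contDiffAt hf e).comp (by fun_prop) hmem))
    simpa using this
  · refine integrableOn_facet S k (hfc.comp (continuous_add_coord_smul S i e).continuousOn ?_)
    intro y hy
    have hy' := (mem_faceOpposite_iff S k).1 hy
    exact hsub i ((add_edge_mem_facet_iff S k i hik hy'.1).2 hy)
  · exact integrableOn_facet S k (hfc.mono (hsub k))

/-- The divergence theorem on a simplex: integration of a directional derivative. -/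
theorem setIntegral_fderiv_simplex {f : Pt d → ℝ}
    (hf : ∀ x ∈ S.closedInterior, ContDiffAt ℝ 1 f x) (v : Pt d) :
    ∫ x in S.closedInterior, fderiv ℝ f x v
      = ∑ m, ⟪outNormal S m, v⟫ * ∫ y in (S.faceOpposite m).closedInterior, f y ∂μHE[d - 1] := by
  have hint : ∀ v, IntegrableOn (fun x => fderiv ℝ f x v) S.closedInterior := fun v =>
    (continuousOn_fderiv_of_contDiffAt hf v).integrableOn_compact (isCompact_closedInterior S)
  -- Both sides are linear in `v`, so the edges at one vertex suffice.
  have hv : v ∈ Submodule.span ℝ (range fun k => S.points k - S.points 0) := by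
    rw [span_edges]; trivial
  induction hv using Submodule.span_induction with
  | mem v hv =>
    obtain ⟨k, rfl⟩ := hv
    by_cases hk : (0 : Fin (d + 1)) = k
    · subst hk; simp
    · rw [setIntegral_fderiv_edge S k 0 hk hf]
      simp_rw [inner_outNormal_edge, sub_mul, Finset.sum_sub_distrib, ite_mul, zero_mul]
      simp
  | zero => simp
  | add u v _ _ hu hv =>
    simp_rw [map_add, inner_add_right, add_mul, Finset.sum_add_distrib]
    rw [integral_add (hint u) (hint v), hu, hv]
  | smul c v _ hv =>
    simp_rw [map_smul, inner_smul_right, mul_assoc, ← Finset.mul_sum, smul_eq_mul]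
    rw [integral_const_mul, hv]

end Divergence

/-! ### Relative interiors and facets in barycentric coordinates. -/

section Barycentric

variable {d : ℕ} (S : Affine.Simplex ℝ (Pt d) d)

theorem affineMap_eq_sum_coord (g : Pt d →ᵃ[ℝ] ℝ) (x : Pt d) :
    g x = ∑ j, (bary S).coord j x * g (S.points j) := by
  have hs := (bary S).sum_coord_apply_eq_one x
  conv_lhs => rw [← affineCombination_coord S x]
  rw [Finset.univ.map_affineCombination _ _ hs, Finset.affineCombination_eq_linear_combination _ _ _ hs]
  rfl

theorem coord_lineMap (k : Fin (d + 1)) (x y : Pt d) (t : ℝ) :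
    (bary S).coord k (AffineMap.lineMap x y t)
      = (1 - t) * (bary S).coord k x + t * (bary S).coord k y := by
  rw [AffineMap.apply_lineMap, AffineMap.lineMap_apply_module, smul_eq_mul, smul_eq_mul]

theorem eventually_coord_lineMap_pos (k : Fin (d + 1)) {x : Pt d} (y : Pt d)
    (hx : 0 < (bary S).coord k x) :
    ∀ᶠ t in 𝓝[>] (0 : ℝ), 0 < (bary S).coord k (AffineMap.lineMap x y t) := by
  have h : ContinuousAt (fun t : ℝ => (bary S).coord k (AffineMap.lineMap x y t)) 0 :=
    ((continuous_coord S k).comp AffineMap.lineMap_continuous).continuousAt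
  have h2 : ∀ᶠ t in 𝓝 (0 : ℝ), 0 < (bary S).coord k (AffineMap.lineMap x y t) :=
    h.eventually (lt_mem_nhds (by simpa using hx))
  exact h2.filter_mono nhdsWithin_le_nhds

variable [NeZero d]

/-- The barycentre of the facet, with weight `1 / d` on each of its `d` vertices. -/
theorem exists_mem_relative_interior (i : Fin (d + 1)) :
    ∃ c : Pt d, (bary S).coord i c = 0 ∧ ∀ j, j ≠ i → 0 < (bary S).coord j c := by
  have hd : (d : ℝ) ≠ 0 := Nat.cast_ne_zero.2 (NeZero.ne d)
  obtain ⟨c, hc⟩ := exists_forall_coord_eq S (w := fun j => if j = i then 0 else (d : ℝ)⁻¹) (by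
    rw [← Finset.add_sum_erase _ _ (Finset.mem_univ i), if_pos rfl, zero_add,
      Finset.sum_congr rfl fun j hj => if_neg (Finset.ne_of_mem_erase hj)]
    simp [hd])
  refine ⟨c, by rw [hc, if_pos rfl], fun j hj => ?_⟩
  rw [hc, if_neg hj]
  have : 0 < d := Nat.pos_of_ne_zero (NeZero.ne d)
  positivity

theorem nonempty_interior_closedInterior : (interior S.closedInterior).Nonempty := by
  obtain ⟨c, hc0, hc⟩ := exists_mem_relative_interior S 0
  rw [interior_closedInterior]
  refine ⟨AffineMap.lineMap c (S.points 0) (1 / 2 : ℝ), fun k => ?_⟩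
  rw [coord_lineMap, coord_points]
  by_cases hk : k = 0
  · subst hk; rw [hc0]; norm_num
  · have := hc k hk
    rw [if_neg hk]
    linarith

theorem facet_injective {i i' : Fin (d + 1)}
    (h : (S.faceOpposite i).closedInterior = (S.faceOpposite i').closedInterior) : i = i' := by
  by_contra hne
  have h1 : S.points i ∈ (S.faceOpposite i').closedInterior :=
    S.point_mem_closedInterior_faceOpposite_iff.2 hne
  rw [← h, S.point_mem_closedInterior_faceOpposite_iff] at h1
  exact h1 rfl

theorem facet_eq_of_image_eq {S' : Affine.Simplex ℝ (Pt d) d} {i i' : Fin (d + 1)}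
    (h : S'.points '' {i'}ᶜ = S.points '' {i}ᶜ) :
    (S'.faceOpposite i').closedInterior = (S.faceOpposite i).closedInterior := by
  rw [← Affine.Simplex.convexHull_eq_closedInterior, ← Affine.Simplex.convexHull_eq_closedInterior,
    Affine.Simplex.range_faceOpposite_points, Affine.Simplex.range_faceOpposite_points, h]

end Barycentric

/-! ### How the elements of a conforming mesh meet along facets. -/

namespace MacroMesh

variable {d : ℕ} {τ ι : Type*} (𝓣 : MacroMesh d τ ι)

theorem isClosed_cell (a : τ) : IsClosed (𝓣.cell a) := (isCompact_closedInterior _).isClosed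

theorem cell_subset_macroCell (a : τ) : 𝓣.cell a ⊆ 𝓣.macroCell (𝓣.mac a) :=
  fun _ hx => mem_iUnion₂.2 ⟨a, rfl, hx⟩

theorem macroCell_subset_closedDomain (K : ι) : 𝓣.macroCell K ⊆ 𝓣.closedDomain := by
  intro x hx
  obtain ⟨b, -, hb⟩ := mem_iUnion₂.1 hx
  exact mem_iUnion.2 ⟨b, hb⟩

variable [NeZero d]

theorem normal_eq (a : τ) (i : Fin (d + 1)) : 𝓣.normal a i = outNormal (𝓣.elem a) i := rfl

theorem facet_subset_cell (a : τ) (i : Fin (d + 1)) : 𝓣.facet a i ⊆ 𝓣.cell a :=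
  (𝓣.elem a).closedInterior_faceOpposite_subset_closedInterior i

theorem disjoint_interior_cell {a b : τ} (h : a ≠ b) :
    Disjoint (interior (𝓣.cell a)) (interior (𝓣.cell b)) := by
  have := 𝓣.disjoint a b h
  rwa [simplex_interior_eq, simplex_interior_eq] at this

/-- An element that meets the relative interior of a facet of another element contains the
vertices of that facet, and these are the vertices of one of its own facets. -/
theorem exists_image_points_eq {a b : τ} (hab : a ≠ b) {i : Fin (d + 1)} {x : Pt d}
    (hxa : x ∈ 𝓣.cell a) (hxb : x ∈ 𝓣.cell b)
    (hx : ∀ j, j ≠ i → 0 < (bary (𝓣.elem a)).coord j x) :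
    ∃ i', (𝓣.elem b).points '' {i'}ᶜ = (𝓣.elem a).points '' {i}ᶜ := by
  classical
  set pa := (𝓣.elem a).points with hpa
  set pb := (𝓣.elem b).points with hpb
  have hconf : 𝓣.cell a ∩ 𝓣.cell b = convexHull ℝ (range pa ∩ range pb) := 𝓣.conforming a b hab
  have hmem : ∀ j, j ≠ i → pa j ∈ range pb := by
    intro j hj
    by_contra hjb
    -- Otherwise the `j`-th coordinate vanishes at every common vertex, hence on the whole
    -- intersection, which contains `x`.
    have hsub : convexHull ℝ (range pa ∩ range pb) ⊆ (bary (𝓣.elem a)).coord j ⁻¹' {0} := by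
      refine convexHull_min ?_ ((convex_singleton 0).affine_preimage _)
      rintro _ ⟨⟨m, rfl⟩, hm⟩
      have hjm : j ≠ m := by
        rintro rfl
        exact hjb hm
      simp [hpa, coord_points, hjm]
    have h0 : (bary (𝓣.elem a)).coord j x = 0 := by
      have : x ∈ convexHull ℝ (range pa ∩ range pb) := hconf ▸ ⟨hxa, hxb⟩
      exact hsub this
    exact (hx j hj).ne' h0
  have hi : pa i ∉ range pb := by
    -- If the vertex `i` were common too, the element `a` would lie inside `b`, against the
    -- disjointness of interiors.
    intro hib
    have hall : range pa ⊆ range pb := by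
      rintro _ ⟨j, rfl⟩
      by_cases hj : j = i
      · rw [hj]; exact hib
      · exact hmem j hj
    have hsub : 𝓣.cell a ⊆ 𝓣.cell b := by
      change (𝓣.elem a).closedInterior ⊆ (𝓣.elem b).closedInterior
      rw [← Affine.Simplex.convexHull_eq_closedInterior,
        ← Affine.Simplex.convexHull_eq_closedInterior]
      exact convexHull_mono hall
    obtain ⟨y, hy⟩ := nonempty_interior_closedInterior (𝓣.elem a)
    exact (𝓣.disjoint_interior_cell hab).le_bot ⟨hy, interior_mono hsub hy⟩
  have hinja : Function.Injective pa := (𝓣.elem a).independent.injective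
  have hinjb : Function.Injective pb := (𝓣.elem b).independent.injective
  set s : Finset (Fin (d + 1)) := Finset.univ.filter fun m => pb m ∈ pa '' {i}ᶜ with hs
  have himg : s.image pb = (Finset.univ.erase i).image pa := by
    ext y
    simp only [hs, Finset.mem_image, Finset.mem_filter, Finset.mem_univ, true_and,
      Finset.mem_erase, and_true]
    constructor
    · rintro ⟨m, ⟨j, hj, hjm⟩, rfl⟩
      exact ⟨j, hj, hjm⟩
    · rintro ⟨j, hj, rfl⟩
      obtain ⟨m, hm⟩ := hmem j hj
      exact ⟨m, ⟨j, hj, hm.symm⟩, hm⟩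
  -- `b` has `d + 1` vertices, `d` of which are those of the facet, so exactly one index is left
  -- over.
  have hcard : sᶜ.card = 1 := by
    have := congrArg Finset.card himg
    rw [Finset.card_image_of_injective _ hinjb, Finset.card_image_of_injective _ hinja,
      Finset.card_erase_of_mem (Finset.mem_univ i), Finset.card_univ, Fintype.card_fin] at this
    rw [Finset.card_compl, this, Fintype.card_fin]
    omega
  obtain ⟨i', hi'⟩ := Finset.card_eq_one.1 hcard
  refine ⟨i', ?_⟩
  have hmems : ∀ m, m ∈ s ↔ m ≠ i' := by
    intro m
    rw [← not_iff_not, not_not, ← Finset.mem_compl, hi', Finset.mem_singleton]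
  ext y
  constructor
  · rintro ⟨m, hm, rfl⟩
    exact (Finset.mem_filter.1 ((hmems m).2 hm)).2
  · rintro ⟨j, hj, rfl⟩
    obtain ⟨m, hm⟩ := hmem j hj
    refine ⟨m, (hmems m).1 ?_, hm⟩
    exact Finset.mem_filter.2 ⟨Finset.mem_univ _, ⟨j, hj, hm.symm⟩⟩

theorem mem_cell_of_relative_interior (a : τ) {i : Fin (d + 1)} {c : Pt d}
    (hc0 : (bary (𝓣.elem a)).coord i c = 0)
    (hc : ∀ j, j ≠ i → 0 < (bary (𝓣.elem a)).coord j c) : c ∈ 𝓣.facet a i := by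
  refine (mem_faceOpposite_iff _ _).2 ⟨hc0, fun j => ?_⟩
  by_cases hj : j = i
  · rw [hj, hc0]
  · exact (hc j hj).le

/-- The outer normals of distinct elements on a common facet are opposite. -/
theorem normal_eq_neg {a b : τ} (hab : a ≠ b) {i i' : Fin (d + 1)}
    (hF : 𝓣.facet b i' = 𝓣.facet a i) : 𝓣.normal b i' = -𝓣.normal a i := by
  obtain ⟨c, hc0, hc⟩ := exists_mem_relative_interior (𝓣.elem a) i
  have hcF : c ∈ 𝓣.facet a i := 𝓣.mem_cell_of_relative_interior a hc0 hc
  obtain ⟨i'', hi''⟩ := 𝓣.exists_image_points_eq hab (𝓣.facet_subset_cell a i hcF)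
    (𝓣.facet_subset_cell b i' (hF ▸ hcF)) hc
  obtain rfl : i' = i'' :=
    facet_injective _ (hF.trans (facet_eq_of_image_eq _ hi'').symm)
  set A := 𝓣.elem a
  set B := 𝓣.elem b
  have hvert : ∀ j, j ≠ i → ∃ m, m ≠ i' ∧ B.points m = A.points j := by
    intro j hj
    have : A.points j ∈ B.points '' {i'}ᶜ := hi'' ▸ ⟨j, hj, rfl⟩
    obtain ⟨m, hm, h⟩ := this
    exact ⟨m, hm, h⟩
  have hvert' : ∀ m, m ≠ i' → ∃ j, j ≠ i ∧ A.points j = B.points m := by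
    intro m hm
    have : B.points m ∈ A.points '' {i}ᶜ := hi'' ▸ ⟨m, hm, rfl⟩
    obtain ⟨j, hj, h⟩ := this
    exact ⟨j, hj, h⟩
  set κ := (bary B).coord i' (A.points i) with hκ
  -- The coordinate of `B` vanishes at the vertices of the common facet, so it is a multiple of the
  -- coordinate of `A`; comparing gradients makes the normals parallel. It remains to find the sign
  -- of the factor `κ`.
  have hprop : ∀ x, (bary B).coord i' x = (bary A).coord i x * κ := by
    intro x
    rw [affineMap_eq_sum_coord A, Finset.sum_eq_single i]
    · intro j _ hj
      obtain ⟨m, hm, h⟩ := hvert j hj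
      rw [← h, coord_points, if_neg hm.symm, mul_zero]
    · simp
  have hA := A.height_pos i
  have hB := B.height_pos i'
  have hinner : ∀ v, ⟪outNormal B i', v⟫ = ⟪(κ * B.height i' / A.height i) • outNormal A i, v⟫ := by
    intro v
    have h1 := coord_add B i' c v
    rw [hprop, hprop, coord_add A i c v] at h1
    rw [inner_smul_left]
    simp only [conj_trivial]
    field_simp at h1 ⊢
    linarith
  have hn : outNormal B i' = (κ * B.height i' / A.height i) • outNormal A i :=
    ext_inner_right ℝ hinner
  have hκle : κ ≤ 0 := by
    -- If `κ > 0`, both elements lie on the same side of the facet: a short move from the facet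
    -- point `c` towards the opposite vertex of `A` enters both interiors.
    by_contra! hpos
    have hcB : ∀ m, m ≠ i' → 0 < (bary B).coord m c := by
      intro m hm
      rw [affineMap_eq_sum_coord A]
      obtain ⟨j₀, hj₀, h₀⟩ := hvert' m hm
      refine Finset.sum_pos' (fun j _ => ?_) ⟨j₀, Finset.mem_univ _, ?_⟩
      · by_cases hj : j = i
        · rw [hj, hc0, zero_mul]
        · obtain ⟨l, -, h⟩ := hvert j hj
          rw [← h, coord_points]
          exact mul_nonneg (hc j hj).le (by split_ifs <;> norm_num)
      · rw [h₀, coord_points, if_pos rfl, mul_one]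
        exact hc j₀ hj₀
    have hev1 : ∀ᶠ t in 𝓝[>] (0 : ℝ), ∀ j, 0 < (bary A).coord j (AffineMap.lineMap c (A.points i) t) := by
      rw [eventually_all]
      intro j
      by_cases hj : j = i
      · filter_upwards [self_mem_nhdsWithin] with t ht
        rw [coord_lineMap, hj, hc0, coord_points, if_pos rfl]
        simpa using ht
      · exact eventually_coord_lineMap_pos A j _ (hc j hj)
    have hev2 : ∀ᶠ t in 𝓝[>] (0 : ℝ), ∀ j, 0 < (bary B).coord j (AffineMap.lineMap c (A.points i) t) := by
      rw [eventually_all]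
      intro j
      by_cases hj : j = i'
      · filter_upwards [hev1] with t ht
        rw [hj, hprop]
        exact mul_pos (ht i) hpos
      · exact eventually_coord_lineMap_pos B j _ (hcB j hj)
    obtain ⟨t, ht1, ht2⟩ := (hev1.and hev2).exists
    have hyA : AffineMap.lineMap c (A.points i) t ∈ interior A.closedInterior := by
      rw [interior_closedInterior]
      exact ht1
    have hyB : AffineMap.lineMap c (A.points i) t ∈ interior B.closedInterior := by
      rw [interior_closedInterior]
      exact ht2
    exact Set.disjoint_left.1 (𝓣.disjoint_interior_cell hab) hyA hyB
  have hnorm := congrArg norm hn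
  rw [norm_smul, norm_outNormal, norm_outNormal, mul_one, Real.norm_eq_abs,
    abs_of_nonpos (div_nonpos_of_nonpos_of_nonneg
      (mul_nonpos_of_nonpos_of_nonneg hκle hB.le) hA.le)] at hnorm
  rw [normal_eq, normal_eq]
  change outNormal B i' = -outNormal A i
  rw [hn, show κ * B.height i' / A.height i = -1 by linarith, neg_one_smul]

theorem normal_ne_zero (a : τ) (i : Fin (d + 1)) : 𝓣.normal a i ≠ 0 := by
  intro h
  have := norm_outNormal (𝓣.elem a) i
  rw [← normal_eq, h, norm_zero] at this
  exact zero_ne_one this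

/-- At most two elements share a facet. -/
theorem eq_of_facet_eq {a b c : τ} {i j k : Fin (d + 1)} (hba : b ≠ a) (hca : c ≠ a)
    (hb : 𝓣.facet b j = 𝓣.facet a i) (hc : 𝓣.facet c k = 𝓣.facet a i) : b = c := by
  by_contra hbc
  -- Three nonzero vectors cannot be pairwise opposite.
  have h1 := 𝓣.normal_eq_neg hba.symm hb
  have h2 := 𝓣.normal_eq_neg hca.symm hc
  have h3 := 𝓣.normal_eq_neg hbc (hc.trans hb.symm)
  rw [h2, h1, neg_neg] at h3
  have h4 : (2 : ℝ) • 𝓣.normal a i = 0 := by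
    rw [two_smul, ← h3]
    nth_rewrite 1 [h3]
    exact add_neg_cancel _
  exact 𝓣.normal_ne_zero a i ((smul_eq_zero.1 h4).resolve_left two_ne_zero)

theorem eq_of_facet_eq_self {a : τ} {i j : Fin (d + 1)} (h : 𝓣.facet a i = 𝓣.facet a j) : i = j :=
  facet_injective _ h

/-- A facet that meets the interior of a union of elements is shared by two of these elements. -/
theorem exists_facet_eq [Finite τ] {A : Set τ} {a : τ} {i : Fin (d + 1)} {x : Pt d}
    (hx : x ∈ 𝓣.facet a i) (hxA : x ∈ interior (⋃ b ∈ A, 𝓣.cell b)) :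
    ∃ b ∈ A, b ≠ a ∧ ∃ i', 𝓣.facet b i' = 𝓣.facet a i := by
  -- The point `x` may lie on a lower-dimensional face; a small move towards `c` stays in the open
  -- set and reaches the relative interior of the facet.
  obtain ⟨c, hc0, hc⟩ := exists_mem_relative_interior (𝓣.elem a) i
  have hx' := (mem_faceOpposite_iff _ _).1 hx
  have hcont : ContinuousAt (fun t : ℝ => AffineMap.lineMap (k := ℝ) x c t) 0 :=
    AffineMap.lineMap_continuous.continuousAt
  have hev : ∀ᶠ t in 𝓝[>] (0 : ℝ), AffineMap.lineMap x c t ∈ interior (⋃ b ∈ A, 𝓣.cell b) := by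
    have : ∀ᶠ t in 𝓝 (0 : ℝ), AffineMap.lineMap x c t ∈ interior (⋃ b ∈ A, 𝓣.cell b) :=
      hcont.eventually (isOpen_interior.mem_nhds (by simpa using hxA))
    exact this.filter_mono nhdsWithin_le_nhds
  obtain ⟨t, ht, ht01⟩ := (hev.and (Ioo_mem_nhdsGT (zero_lt_one' ℝ))).exists
  set y := AffineMap.lineMap (k := ℝ) x c t with hy
  have hy0 : (bary (𝓣.elem a)).coord i y = 0 := by
    rw [hy, coord_lineMap, hc0, hx'.1]; ring
  have hypos : ∀ j, j ≠ i → 0 < (bary (𝓣.elem a)).coord j y := by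
    intro j hj
    rw [hy, coord_lineMap]
    exact add_pos_of_nonneg_of_pos (mul_nonneg (by linarith [ht01.2]) (hx'.2 j))
      (mul_pos ht01.1 (hc j hj))
  have hyF : y ∈ 𝓣.facet a i := 𝓣.mem_cell_of_relative_interior a hy0 hypos
  have hyb : ∃ b ∈ A, b ≠ a ∧ y ∈ 𝓣.cell b := by
    by_contra! hno
    -- The other elements form a closed set. If it missed `y`, a neighbourhood of `y` would lie in
    -- `a`, although `y` is on a facet of `a`.
    have hcl : IsClosed (⋃ b ∈ A \ {a}, 𝓣.cell b) :=
      (toFinite _).isClosed_biUnion fun b _ => 𝓣.isClosed_cell b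
    have hya : y ∈ interior (𝓣.cell a) := by
      refine mem_interior.2 ⟨interior (⋃ b ∈ A, 𝓣.cell b) ∩ (⋃ b ∈ A \ {a}, 𝓣.cell b)ᶜ, ?_,
        isOpen_interior.inter hcl.isOpen_compl, ht, ?_⟩
      · rintro z ⟨hz1, hz2⟩
        obtain ⟨b, hb, hzb⟩ := mem_iUnion₂.1 (interior_subset hz1)
        by_cases hba : b = a
        · rwa [← hba]
        · exact absurd (mem_iUnion₂.2 ⟨b, ⟨hb, hba⟩, hzb⟩) hz2
      · intro hy2
        obtain ⟨b, hb, hyb⟩ := mem_iUnion₂.1 hy2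
        exact hno b hb.1 hb.2 hyb
    have : y ∈ interior (𝓣.elem a).closedInterior := hya
    rw [interior_closedInterior] at this
    exact (this i).ne' hy0
  obtain ⟨b, hbA, hba, hyb⟩ := hyb
  obtain ⟨i', hi'⟩ := 𝓣.exists_image_points_eq hba.symm (𝓣.facet_subset_cell a i hyF) hyb hypos
  exact ⟨b, hbA, hba, i', facet_eq_of_image_eq _ hi'⟩

theorem exists_facet_eq_of_not_onMacroBoundary [Finite τ] {a : τ} {i : Fin (d + 1)}
    (h : ¬ 𝓣.OnMacroBoundary a i) :
    ∃ b i', b ≠ a ∧ 𝓣.mac b = 𝓣.mac a ∧ 𝓣.facet b i' = 𝓣.facet a i := by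
  obtain ⟨x, hx, hxf⟩ := not_subset.1 h
  have hxm : x ∈ 𝓣.macroCell (𝓣.mac a) :=
    𝓣.cell_subset_macroCell a (𝓣.facet_subset_cell a i hx)
  have hxi : x ∈ interior (𝓣.macroCell (𝓣.mac a)) := by
    by_contra hni
    exact hxf ⟨subset_closure hxm, hni⟩
  obtain ⟨b, hb, hba, i', hi'⟩ := 𝓣.exists_facet_eq hx hxi
  exact ⟨b, i', hba, hb, hi'⟩

theorem exists_facet_eq_of_not_onBoundary [Finite τ] {a : τ} {i : Fin (d + 1)}
    (h : ¬ 𝓣.OnBoundary a i) :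
    ∃ b i', b ≠ a ∧ 𝓣.facet b i' = 𝓣.facet a i := by
  obtain ⟨x, hx, hxf⟩ := not_subset.1 h
  have hxm : x ∈ 𝓣.closedDomain := mem_iUnion.2 ⟨a, 𝓣.facet_subset_cell a i hx⟩
  have hxi : x ∈ interior (⋃ b ∈ (univ : Set τ), 𝓣.cell b) := by
    rw [biUnion_univ]
    by_contra hni
    exact hxf ⟨subset_closure hxm, hni⟩
  obtain ⟨b, -, hba, i', hi'⟩ := 𝓣.exists_facet_eq hx hxi
  exact ⟨b, i', hba, hi'⟩

theorem OnBoundary.onMacroBoundary {𝓣 : MacroMesh d τ ι} {a : τ} {i : Fin (d + 1)}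
    (h : 𝓣.OnBoundary a i) : 𝓣.OnMacroBoundary a i := fun _ hx =>
  ⟨subset_closure (𝓣.cell_subset_macroCell a (𝓣.facet_subset_cell a i hx)), fun hi =>
    (h hx).2 (interior_mono (𝓣.macroCell_subset_closedDomain _) hi)⟩

theorem onBoundary_congr {a b : τ} {i i' : Fin (d + 1)} (h : 𝓣.facet b i' = 𝓣.facet a i) :
    𝓣.OnBoundary b i' ↔ 𝓣.OnBoundary a i := by
  rw [OnBoundary, OnBoundary, h]

/-- A facet shared by two elements is on the boundary of both macro-elements or of none. -/
theorem OnMacroBoundary.of_facet_eq [Finite τ] {𝓣 : MacroMesh d τ ι} {a b : τ}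
    {i i' : Fin (d + 1)} (h : 𝓣.facet b i' = 𝓣.facet a i) (ha : 𝓣.OnMacroBoundary a i) :
    𝓣.OnMacroBoundary b i' := by
  by_cases hm : 𝓣.mac b = 𝓣.mac a
  · rwa [OnMacroBoundary, h, hm]
  by_contra hb
  obtain ⟨c, k, hcb, hmc, hc⟩ := 𝓣.exists_facet_eq_of_not_onMacroBoundary hb
  have hab : a ≠ b := fun h => hm (h ▸ rfl)
  -- The neighbour `c` of `b` inside its macro-element and the element `a` share the same facet with
  -- `b`, and there is room for only one neighbour.
  have hca : a = c := 𝓣.eq_of_facet_eq hab hcb h.symm hc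
  exact hm (by rw [hca, hmc])

open Classical in
/-- Contributions of opposite sign from the two sides of the facets cancel. -/
theorem sum_facets_eq_zero [Fintype τ] (R : τ → Fin (d + 1) → Prop) (G : τ → Fin (d + 1) → ℝ)
    (hR : ∀ a i, R a i → ∃ b i', b ≠ a ∧ R b i' ∧ 𝓣.facet b i' = 𝓣.facet a i ∧
      G b i' = -G a i) :
    ∑ a, ∑ i, (if R a i then G a i else 0) = 0 := by
  rw [← Finset.sum_product', ← Finset.sum_filter]
  choose! f g hne hRfg hfac hG using hR
  refine Finset.sum_involution (fun p _ => (f p.1 p.2, g p.1 p.2)) ?_ ?_ ?_ ?_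
  · rintro ⟨a, i⟩ hp
    have := (Finset.mem_filter.1 hp).2
    simp [hG a i this]
  · rintro ⟨a, i⟩ hp - heq
    have := (Finset.mem_filter.1 hp).2
    exact hne a i this (Prod.ext_iff.1 heq).1
  · rintro ⟨a, i⟩ hp
    have := (Finset.mem_filter.1 hp).2
    simpa using hRfg a i this
  · rintro ⟨a, i⟩ hp
    have h1 : R a i := (Finset.mem_filter.1 hp).2
    have h2 := hRfg a i h1
    -- Uniqueness of the neighbour across a facet makes the arbitrarily chosen neighbour map an
    -- involution.
    have h3 : f (f a i) (g a i) = a :=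
      𝓣.eq_of_facet_eq (hne _ _ h2) (hne a i h1).symm (hfac _ _ h2) (hfac a i h1).symm
    have h4 := (hfac _ _ h2).trans (hfac a i h1)
    rw [h3] at h4
    exact Prod.ext h3 (𝓣.eq_of_facet_eq_self h4)

end MacroMesh

/-! ### Calculus for state vectors. -/

namespace State

variable {d : ℕ}

theorem dotProduct_eq (u y : State d) :
    u ⬝ᵥ y = u.fst * y.fst + ∑ j, u.mid j * y.mid j + u.lst * y.lst := by
  rw [dotProduct, Fin.sum_univ_succ, Fin.sum_univ_castSucc, ← add_assoc]
  rfl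

theorem contDiffAt_mk {E : Type*} [NormedAddCommGroup E] [NormedSpace ℝ E] {n : ℕ∞} {x : E}
    {a c : E → ℝ} {b : E → Fin d → ℝ} (ha : ContDiffAt ℝ n a x)
    (hb : ∀ j, ContDiffAt ℝ n (fun z => b z j) x) (hc : ContDiffAt ℝ n c x) :
    ContDiffAt ℝ n (fun z => mk (a z) (b z) (c z)) x := by
  rw [contDiffAt_pi]
  intro i
  refine Fin.cases ?_ (fun k => ?_) i
  · exact ha
  · refine Fin.lastCases ?_ (fun j => ?_) k
    · simpa only [mk, Fin.cons_succ, Fin.snoc_last] using hc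
    · simpa only [mk, Fin.cons_succ, Fin.snoc_castSucc] using hb j

theorem hasDerivAt_mk {t : ℝ} {a c : ℝ → ℝ} {b : ℝ → Fin d → ℝ} {a' c' : ℝ} {b' : Fin d → ℝ}
    (ha : HasDerivAt a a' t) (hb : ∀ j, HasDerivAt (fun r => b r j) (b' j) t)
    (hc : HasDerivAt c c' t) : HasDerivAt (fun r => mk (a r) (b r) (c r)) (mk a' b' c') t := by
  rw [hasDerivAt_pi]
  intro i
  refine Fin.cases ?_ (fun k => ?_) i
  · exact ha
  · refine Fin.lastCases ?_ (fun j => ?_) k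
    · simpa only [mk, Fin.cons_succ, Fin.snoc_last] using hc
    · simpa only [mk, Fin.cons_succ, Fin.snoc_castSucc] using hb j

theorem contDiff_fst {n : ℕ∞} : ContDiff ℝ n (fun y : State d => y.fst) := contDiff_apply ℝ ℝ _

theorem contDiff_mid {n : ℕ∞} (j : Fin d) : ContDiff ℝ n (fun y : State d => y.mid j) :=
  contDiff_apply ℝ ℝ _

theorem contDiff_lst {n : ℕ∞} : ContDiff ℝ n (fun y : State d => y.lst) := contDiff_apply ℝ ℝ _

end State

/-! ### Entropy variables: regularity and the two gradient relations. -/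

section Euler

variable {d : ℕ} {γ : ℝ}

theorem isOpen_admissible : IsOpen {y : State d | Admissible y} :=
  isOpen_Iio.preimage (State.contDiff_lst (n := 0)).continuous

theorem Admissible.eventually {y : State d} (hy : Admissible y) : ∀ᶠ z in 𝓝 y, Admissible z :=
  isOpen_admissible.mem_nhds hy

theorem Admissible.neg_lst_ne_zero {y : State d} (hy : Admissible y) : -y.lst ≠ 0 :=
  (neg_pos.2 hy).ne'

theorem fst_consVars (y : State d) : (consVars γ y).fst = -y.lst * pressureOfVars γ y := by
  simp [consVars]

theorem lst_consVars (y : State d) : (consVars γ y).lst = pressureOfVars γ y / (γ - 1)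
    + -y.lst * pressureOfVars γ y * (∑ j, (y.mid j / -y.lst) ^ 2) / 2 := by
  simp [consVars]

/-- This is read off from the first component of `entropyVars_consVars`. -/
theorem specificEntropy_consVars (hγ : 1 < γ) {y : State d} (hy : Admissible y) :
    specificEntropy γ (consVars γ y)
      = γ - (γ - 1) * (y.fst + -y.lst * (∑ j, (y.mid j / -y.lst) ^ 2) / 2) := by
  have h1 : γ - 1 ≠ 0 := by linarith
  have hP : pressureOfVars γ y ≠ 0 := (Real.exp_pos _).ne'
  have h := congrArg State.fst (entropyVars_consVars hγ hy)
  rw [entropyVars, State.fst_mk, pressure_consVars hγ hy, fst_consVars,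
    mul_div_cancel_right₀ _ hP] at h
  simp_rw [velocity_consVars hy] at h
  rw [← h]
  field_simp
  ring

theorem potential_eq_mul {y : State d} (hy : Admissible y) (j : Fin d) :
    potential γ y j = -y.lst * pressureOfVars γ y * (y.mid j / -y.lst) := by
  rw [potential, velocity_consVars hy, fst_consVars]

/-- The second factor is arbitrary because it is the state itself in `potential_eq` and a variation
in `fderiv_potential`. -/
theorem flux_dotProduct (hγ : 1 < γ) {y : State d} (hy : Admissible y) (j : Fin d) (z : State d) :
    flux γ (consVars γ y) j ⬝ᵥ z
      = -y.lst * pressureOfVars γ y * (y.mid j / -y.lst) * (z.fst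
          + ∑ k, y.mid k / -y.lst * z.mid k)
        + pressureOfVars γ y * z.mid j
        + (pressureOfVars γ y / (γ - 1)
          + -y.lst * pressureOfVars γ y * (∑ j, (y.mid j / -y.lst) ^ 2) / 2
          + pressureOfVars γ y) * (y.mid j / -y.lst) * z.lst := by
  rw [State.dotProduct_eq, flux, State.fst_mk, State.mid_mk, State.lst_mk,
    pressure_consVars hγ hy, fst_consVars, lst_consVars]
  simp_rw [velocity_consVars hy, add_mul, Finset.sum_add_distrib, ite_mul, zero_mul,
    Finset.sum_ite_eq' Finset.univ j]
  have hs : ∑ k, -y.lst * pressureOfVars γ y * (y.mid k / -y.lst) * (y.mid j / -y.lst) * z.mid k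
      = -y.lst * pressureOfVars γ y * (y.mid j / -y.lst) * ∑ k, y.mid k / -y.lst * z.mid k := by
    rw [Finset.mul_sum]
    exact Finset.sum_congr rfl fun k _ => by ring
  rw [if_pos (Finset.mem_univ j), hs]
  generalize ∑ k, y.mid k / -y.lst * z.mid k = r
  generalize ∑ k, (y.mid k / -y.lst) ^ 2 = q
  ring

/-- The entropy potential satisfies `Ψ = Fᵀ v - 𝓕`. -/
theorem potential_eq (hγ : 1 < γ) {y : State d} (hy : Admissible y) (j : Fin d) :
    potential γ y j = flux γ (consVars γ y) j ⬝ᵥ y - entropyFlux γ (consVars γ y) j := by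
  have h1 : γ - 1 ≠ 0 := by linarith
  have hb := hy.neg_lst_ne_zero
  rw [potential_eq_mul hy, flux_dotProduct hγ hy, entropyFlux, velocity_consVars hy, fst_consVars,
    specificEntropy_consVars hγ hy]
  set b := -y.lst with hbdef
  have hl : y.lst = -b := by rw [hbdef, neg_neg]
  have hm : ∀ k, y.mid k = b * (y.mid k / b) := fun k => (mul_div_cancel₀ _ hb).symm
  have hsum : ∑ k, y.mid k / b * y.mid k = b * ∑ k, (y.mid k / b) ^ 2 := by
    rw [Finset.mul_sum]
    exact Finset.sum_congr rfl fun k _ => by field_simp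
  rw [hsum, hl]
  generalize ∑ k, (y.mid k / b) ^ 2 = q
  field_simp
  ring

theorem contDiffAt_velocityOfVars {y : State d} (hy : Admissible y) {n : ℕ∞} (j : Fin d) :
    ContDiffAt ℝ n (fun z : State d => z.mid j / -z.lst) y :=
  (State.contDiff_mid j).contDiffAt.div State.contDiff_lst.contDiffAt.neg hy.neg_lst_ne_zero

theorem contDiffAt_speedSq {y : State d} (hy : Admissible y) {n : ℕ∞} :
    ContDiffAt ℝ n (fun z : State d => ∑ j, (z.mid j / -z.lst) ^ 2) y :=
  ContDiffAt.sum fun j _ => (contDiffAt_velocityOfVars hy j).pow 2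

theorem contDiffAt_pressureOfVars {y : State d} (hy : Admissible y) {n : ℕ∞} :
    ContDiffAt ℝ n (fun z : State d => pressureOfVars γ z) y := by
  unfold pressureOfVars
  have h1 := (State.contDiff_fst (d := d) (n := n)).contDiffAt (x := y)
  have h2 := (State.contDiff_lst (d := d) (n := n)).contDiffAt (x := y)
  exact ((((contDiffAt_const.sub (contDiffAt_const.mul (h1.add
    ((h2.neg.mul (contDiffAt_speedSq hy)).div_const _)))).add
    (contDiffAt_const.mul (h2.neg.log hy.neg_lst_ne_zero))).neg).div_const _).exp

theorem contDiffAt_consVars {y : State d} (hy : Admissible y) {n : ℕ∞} :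
    ContDiffAt ℝ n (consVars γ : State d → State d) y := by
  have h2 := (State.contDiff_lst (d := d) (n := n)).contDiffAt (x := y)
  have hP := contDiffAt_pressureOfVars (γ := γ) hy (n := n)
  exact State.contDiffAt_mk (h2.neg.mul hP)
    (fun j => (h2.neg.mul hP).mul (contDiffAt_velocityOfVars hy j))
    ((hP.div_const _).add (((h2.neg.mul hP).mul (contDiffAt_speedSq hy)).div_const _))

/-- The explicit formula is established at admissible states only; these form an open set, so it may
still be differentiated. -/
theorem potential_eventuallyEq {y : State d} (hy : Admissible y) (j : Fin d) :
    (fun z : State d => potential γ z j)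
      =ᶠ[𝓝 y] fun z => -z.lst * pressureOfVars γ z * (z.mid j / -z.lst) := by
  filter_upwards [hy.eventually] with z hz
  exact potential_eq_mul hz j

theorem contDiffAt_potential {y : State d} (hy : Admissible y) {n : ℕ∞} (j : Fin d) :
    ContDiffAt ℝ n (fun z : State d => potential γ z j) y :=
  ((State.contDiff_lst.contDiffAt.neg.mul (contDiffAt_pressureOfVars hy)).mul
    (contDiffAt_velocityOfVars hy j)).congr_of_eventuallyEq (potential_eventuallyEq hy j)

theorem genEntropy_eventuallyEq (hγ : 1 < γ) {y : State d} (hy : Admissible y) :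
    (fun z : State d => genEntropy γ (consVars γ z)) =ᶠ[𝓝 y] fun z =>
      -(-z.lst * pressureOfVars γ z
        * (γ - (γ - 1) * (z.fst + -z.lst * (∑ j, (z.mid j / -z.lst) ^ 2) / 2))) / (γ - 1) := by
  filter_upwards [hy.eventually] with z hz
  rw [genEntropy, specificEntropy_consVars hγ hz, fst_consVars]

theorem contDiffAt_genEntropy (hγ : 1 < γ) {y : State d} (hy : Admissible y) {n : ℕ∞} :
    ContDiffAt ℝ n (fun z : State d => genEntropy γ (consVars γ z)) y := by
  have h1 := (State.contDiff_fst (d := d) (n := n)).contDiffAt (x := y)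
  have h2 := (State.contDiff_lst (d := d) (n := n)).contDiffAt (x := y)
  refine ContDiffAt.congr_of_eventuallyEq ?_ (genEntropy_eventuallyEq hγ hy)
  exact (((h2.neg.mul (contDiffAt_pressureOfVars hy)).mul (contDiffAt_const.sub
    (contDiffAt_const.mul (h1.add ((h2.neg.mul (contDiffAt_speedSq hy)).div_const _))))).neg).div_const _

theorem contDiffAt_entropyFlux (hγ : 1 < γ) {y : State d} (hy : Admissible y) {n : ℕ∞} (j : Fin d) :
    ContDiffAt ℝ n (fun z : State d => entropyFlux γ (consVars γ z) j) y := by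
  refine ((contDiffAt_genEntropy hγ hy).mul
    (contDiffAt_velocityOfVars hy j)).congr_of_eventuallyEq ?_
  filter_upwards [hy.eventually] with z hz
  rw [entropyFlux, genEntropy, velocity_consVars hz]
  ring

section Line

variable {y δ : State d}

theorem hasDerivAt_line : HasDerivAt (fun r : ℝ => y + r • δ) δ 0 := by
  simpa using ((hasDerivAt_id (0 : ℝ)).smul_const δ).const_add y

theorem hasDerivAt_fst_line : HasDerivAt (fun r : ℝ => (y + r • δ).fst) δ.fst 0 :=
  hasDerivAt_pi.1 hasDerivAt_line _

theorem hasDerivAt_mid_line (j : Fin d) :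
    HasDerivAt (fun r : ℝ => (y + r • δ).mid j) (δ.mid j) 0 :=
  hasDerivAt_pi.1 hasDerivAt_line _

theorem hasDerivAt_neg_lst_line : HasDerivAt (fun r : ℝ => -(y + r • δ).lst) (-δ.lst) 0 :=
  (hasDerivAt_pi.1 hasDerivAt_line _).neg

/-- Variation of the velocity with the entropy variables. -/
noncomputable def velocityVar (y δ : State d) (j : Fin d) : ℝ :=
  (δ.mid j * -y.lst - y.mid j * -δ.lst) / (-y.lst) ^ 2

/-- Variation of the squared speed with the entropy variables. -/
noncomputable def speedSqVar (y δ : State d) : ℝ :=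
  ∑ j, 2 * (y.mid j / -y.lst) * velocityVar y δ j

/-- Variation of the pressure with the entropy variables. -/
noncomputable def pressureVar (γ : ℝ) (y δ : State d) : ℝ :=
  pressureOfVars γ y * (δ.fst + (-δ.lst * (∑ j, (y.mid j / -y.lst) ^ 2)
    + -y.lst * speedSqVar y δ) / 2 - γ / (γ - 1) * (-δ.lst / -y.lst))

theorem hasDerivAt_velocity_line (hy : Admissible y) (j : Fin d) :
    HasDerivAt (fun r : ℝ => (y + r • δ).mid j / -(y + r • δ).lst) (velocityVar y δ j) 0 := by
  have := (hasDerivAt_mid_line (y := y) (δ := δ) j).fun_div (hasDerivAt_neg_lst_line (δ := δ))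
    (by simpa using hy.neg_lst_ne_zero)
  simpa [velocityVar] using this

theorem hasDerivAt_speedSq_line (hy : Admissible y) :
    HasDerivAt (fun r : ℝ => ∑ j, ((y + r • δ).mid j / -(y + r • δ).lst) ^ 2)
      (speedSqVar y δ) 0 := by
  have := HasDerivAt.fun_sum (u := Finset.univ) fun j _ =>
    (hasDerivAt_velocity_line (δ := δ) hy j).pow 2
  simpa [speedSqVar] using this

theorem hasDerivAt_pressure_line (hγ : 1 < γ) (hy : Admissible y) :
    HasDerivAt (fun r : ℝ => pressureOfVars γ (y + r • δ)) (pressureVar γ y δ) 0 := by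
  have h1 : γ - 1 ≠ 0 := by linarith
  have hb := hy.neg_lst_ne_zero
  have hl := hasDerivAt_neg_lst_line (y := y) (δ := δ)
  have := ((((((hasDerivAt_fst_line (y := y) (δ := δ)).add
    ((hl.mul (hasDerivAt_speedSq_line (δ := δ) hy)).div_const 2)).const_mul (γ - 1)).const_sub
      γ).add ((hl.log (by simpa using hb)).const_mul γ)).neg.div_const (γ - 1)).exp
  refine this.congr_deriv ?_
  simp only [zero_smul, add_zero, Pi.add_apply, Pi.neg_apply, Pi.mul_apply]
  rw [pressureVar]
  congr 1
  field_simp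
  ring

theorem hasDerivAt_density_line (hγ : 1 < γ) (hy : Admissible y) :
    HasDerivAt (fun r : ℝ => -(y + r • δ).lst * pressureOfVars γ (y + r • δ))
      (-δ.lst * pressureOfVars γ y + -y.lst * pressureVar γ y δ) 0 := by
  simpa using (hasDerivAt_neg_lst_line (y := y) (δ := δ)).fun_mul
    (hasDerivAt_pressure_line (δ := δ) hγ hy)

/-- Reduces directional values of Fréchet derivatives to one-variable calculus. -/
theorem fderiv_eq_of_hasDerivAt_line {E : Type*} [NormedAddCommGroup E] [NormedSpace ℝ E]
    {h : State d → E} {h' : E} (hh : DifferentiableAt ℝ h y)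
    (hl : HasDerivAt (fun r : ℝ => h (y + r • δ)) h' 0) : fderiv ℝ h y δ = h' := by
  have h0 : HasFDerivAt h (fderiv ℝ h y) (y + (0 : ℝ) • δ) := by simpa using hh.hasFDerivAt
  exact (h0.comp_hasDerivAt (0 : ℝ) hasDerivAt_line).unique hl

theorem mid_eq_mul (hy : Admissible y) (j : Fin d) : y.mid j = -y.lst * (y.mid j / -y.lst) :=
  (mul_div_cancel₀ _ hy.neg_lst_ne_zero).symm

theorem mid_var_eq (hy : Admissible y) (j : Fin d) :
    δ.mid j = -δ.lst * (y.mid j / -y.lst) + -y.lst * velocityVar y δ j := by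
  have hb := hy.neg_lst_ne_zero
  rw [velocityVar]
  generalize -y.lst = b at *
  field_simp
  ring

/-- The gradient of the entropy with respect to the conservative variables is `v`. -/
theorem fderiv_genEntropy (hγ : 1 < γ) (hy : Admissible y) :
    fderiv ℝ (fun z : State d => genEntropy γ (consVars γ z)) y δ
      = fderiv ℝ (consVars γ) y δ ⬝ᵥ y := by
  have h1 : γ - 1 ≠ 0 := by linarith
  have hb := hy.neg_lst_ne_zero
  have hρ := hasDerivAt_density_line (δ := δ) hγ hy
  have hP := hasDerivAt_pressure_line (δ := δ) hγ hy
  have hq := hasDerivAt_speedSq_line (δ := δ) hy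
  have hcons := State.hasDerivAt_mk hρ (fun j => hρ.mul (hasDerivAt_velocity_line (δ := δ) hy j))
    ((hP.div_const (γ - 1)).add ((hρ.mul hq).div_const 2))
  rw [fderiv_eq_of_hasDerivAt_line
    ((contDiffAt_consVars hy (n := 1)).differentiableAt (by norm_num)) hcons]
  have hdiff := (contDiffAt_genEntropy hγ hy (n := 1)).differentiableAt (by norm_num)
  rw [(genEntropy_eventuallyEq hγ hy).fderiv_eq]
  have hH := (hρ.mul ((((hasDerivAt_fst_line (y := y) (δ := δ)).add
    (((hasDerivAt_neg_lst_line (y := y) (δ := δ)).mul hq).div_const 2)).const_mul (γ - 1)).const_sub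
      γ)).neg.div_const (γ - 1)
  rw [fderiv_eq_of_hasDerivAt_line
    (hdiff.congr_of_eventuallyEq (genEntropy_eventuallyEq hγ hy).symm) hH]
  rw [State.dotProduct_eq, State.fst_mk, State.mid_mk, State.lst_mk]
  simp only [zero_smul, add_zero, Pi.add_apply, Pi.mul_apply]
  set b := -y.lst with hbdef
  have hl : y.lst = -b := by rw [hbdef, neg_neg]
  set P := pressureOfVars γ y
  set q := ∑ k, (y.mid k / b) ^ 2 with hqdef
  set ρ' := -δ.lst * P + b * pressureVar γ y δ with hρ'
  -- Here the momentum block of `y` is `b V`, so the pairing collapses to the squared speed `q =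
  -- |V|²` and its variation `2 V · V'`.
  have hsum : ∑ j, (ρ' * (y.mid j / b) + b * P * velocityVar y δ j) * y.mid j
      = b * (ρ' * q + b * P * speedSqVar y δ / 2) := by
    rw [hqdef, speedSqVar, ← hbdef, Finset.mul_sum, Finset.mul_sum, Finset.sum_div,
      ← Finset.sum_add_distrib, Finset.mul_sum]
    refine Finset.sum_congr rfl fun k _ => ?_
    nth_rewrite 2 [mid_eq_mul hy k]
    rw [← hbdef]
    ring
  have hpv : pressureVar γ y δ = P * (δ.fst + (-δ.lst * q + b * speedSqVar y δ) / 2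
      - γ / (γ - 1) * (-δ.lst / b)) := rfl
  rw [hsum, hl, hρ', hpv]
  generalize speedSqVar y δ = q'
  -- The transcendental formula for the pressure is no longer needed: with its logarithmic
  -- derivative inserted, what remains is a rational identity in independent quantities.
  clear_value P q b
  field_simp
  ring

/-- The gradient of the entropy potential with respect to the entropy variables is the flux. -/
theorem fderiv_potential (hγ : 1 < γ) (hy : Admissible y) (j : Fin d) :
    fderiv ℝ (fun z : State d => potential γ z j) y δ = flux γ (consVars γ y) j ⬝ᵥ δ := by
  have h1 : γ - 1 ≠ 0 := by linarith
  have hb := hy.neg_lst_ne_zero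
  have hdiff := (contDiffAt_potential (γ := γ) hy (n := 1) j).differentiableAt (by norm_num)
  rw [(potential_eventuallyEq hy j).fderiv_eq, fderiv_eq_of_hasDerivAt_line
    (hdiff.congr_of_eventuallyEq (potential_eventuallyEq hy j).symm)
    ((hasDerivAt_density_line hγ hy).mul (hasDerivAt_velocity_line (δ := δ) hy j)), flux_dotProduct hγ hy]
  simp only [zero_smul, add_zero]
  -- The product rule for `b V`, paired with `V`; half the variation of `|V|²` appears.
  have hsum : ∑ k, y.mid k / -y.lst * δ.mid k
      = -δ.lst * (∑ k, (y.mid k / -y.lst) ^ 2) + -y.lst * speedSqVar y δ / 2 := by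
    rw [speedSqVar, Finset.mul_sum, Finset.mul_sum, Finset.sum_div, ← Finset.sum_add_distrib]
    refine Finset.sum_congr rfl fun k _ => ?_
    rw [mid_var_eq (δ := δ) hy k]
    ring
  rw [hsum, mid_var_eq (δ := δ) hy j, pressureVar]
  generalize velocityVar y δ j = V'
  generalize ∑ k, (y.mid k / -y.lst) ^ 2 = q
  generalize speedSqVar y δ = q'
  have hl : δ.lst = -(-δ.lst) := by ring
  generalize -δ.lst = b' at *
  rw [hl]
  generalize -y.lst = b at *
  field_simp
  ring

end Line

end Euler

/-! ### Polynomial interpolation and differentiation under the integral. -/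

/-- Lagrange interpolation in a finite-dimensional space of functions: there are finitely many
nodes whose values determine the function, linearly. -/
theorem exists_interpolation {X : Type*} {M : Type*} [AddCommGroup M] [Module ℝ M]
    [FiniteDimensional ℝ M] (ev : X → M →ₗ[ℝ] ℝ) :
    ∃ (n : ℕ) (x : Fin n → X) (φ : Fin n → M),
      ∀ (f : M) (z : X), ev z f = ∑ i, ev (x i) f * ev z (φ i) := by
  induction hN : Module.finrank ℝ M using Nat.strong_induction_on generalizing M with
  | _ N ih =>
  by_cases h0 : ∀ z f, ev z f = 0
  · exact ⟨0, Fin.elim0, Fin.elim0, fun f z => by simp [h0]⟩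
  push Not at h0
  obtain ⟨x₀, f₀, hf₀⟩ := h0
  have hlt : Module.finrank ℝ (LinearMap.ker (ev x₀)) < N := by
    rw [← hN]
    refine Submodule.finrank_lt fun htop => hf₀ ?_
    have : f₀ ∈ LinearMap.ker (ev x₀) := htop ▸ Submodule.mem_top
    exact this
  obtain ⟨n, x, φ, h⟩ := ih _ hlt (fun z => ev z ∘ₗ (LinearMap.ker (ev x₀)).subtype) rfl
  -- The old nodes and functions handle functions vanishing at `x₀`, such as `f` minus a multiple of
  -- `f₀`. The new function is the interpolation defect of `f₀` at the old nodes, scaled by its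
  -- value at `x₀`.
  refine ⟨n + 1, Fin.cons x₀ x, Fin.cons
    ((ev x₀ f₀)⁻¹ • (f₀ - ∑ i, ev (x i) f₀ • (φ i : M))) (fun i => (φ i : M)), fun f z => ?_⟩
  have hmem : f - (ev x₀ f / ev x₀ f₀) • f₀ ∈ LinearMap.ker (ev x₀) := by
    rw [LinearMap.mem_ker, map_sub, map_smul, smul_eq_mul, div_mul_cancel₀ _ hf₀, sub_self]
  have hz := h ⟨_, hmem⟩ z
  simp only [LinearMap.comp_apply, Submodule.subtype_apply, map_sub, map_smul, smul_eq_mul,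
    sub_mul, Finset.sum_sub_distrib] at hz
  rw [Fin.sum_univ_succ]
  simp only [Fin.cons_zero, Fin.cons_succ, map_smul, map_sub, map_sum, smul_eq_mul]
  have h3 : ∑ i, ev x₀ f / ev x₀ f₀ * ev (x i) f₀ * ev z (φ i)
      = ev x₀ f / ev x₀ f₀ * ∑ i, ev (x i) f₀ * ev z (φ i) := by
    rw [Finset.mul_sum]
    exact Finset.sum_congr rfl fun i _ => by ring
  rw [h3] at hz
  have h4 : ev z f = ev x₀ f / ev x₀ f₀ * ev z f₀ + (∑ i, ev (x i) f * ev z (φ i)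
      - ev x₀ f / ev x₀ f₀ * ∑ i, ev (x i) f₀ * ev z (φ i)) := by linarith
  rw [h4]
  ring

theorem contDiff_mvPolynomial_eval {d : ℕ} (q : MvPolynomial (Fin d) ℝ) {n : ℕ∞} :
    ContDiff ℝ n fun x : Pt d => MvPolynomial.eval (fun j => x j) q := by
  induction q using MvPolynomial.induction_on with
  | C a => simpa using contDiff_const
  | add p q hp hq => simpa using hp.add hq
  | mul_X p j hp =>
    simp only [map_mul, MvPolynomial.eval_X]
    exact hp.mul (by fun_prop)

/-- Evaluations are taken at points of `D` only, so `D` need not determine the polynomial. Nodes and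
weights do not depend on `f`: a field moving in time is a fixed linear combination of its node
values. -/
theorem PolyOn.exists_interpolation {d : ℕ} (p : ℕ) (D : Set (Pt d)) :
    ∃ (n : ℕ) (x : Fin n → Pt d) (φ : Fin n → Pt d → ℝ), (∀ i, x i ∈ D) ∧
      (∀ i, Continuous (φ i)) ∧
      ∀ f : Pt d → ℝ, PolyOn p D f → ∀ z ∈ D, f z = ∑ i, f (x i) * φ i z := by
  obtain ⟨n, x, q, h⟩ := HDG.exists_interpolation (X := D)
    (M := MvPolynomial.restrictTotalDegree (Fin d) ℝ p)
    (fun z => (MvPolynomial.aeval (R := ℝ) (fun j => (z : Pt d) j)).toLinearMap ∘ₗ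
      (MvPolynomial.restrictTotalDegree (Fin d) ℝ p).subtype)
  refine ⟨n, fun i => x i, fun i z => MvPolynomial.eval (fun j => z j) (q i : MvPolynomial _ ℝ),
    fun i => (x i).2, fun i => (contDiff_mvPolynomial_eval (n := 0) _).continuous, ?_⟩
  rintro f ⟨r, hr, hfr⟩ z hz
  have := h ⟨r, (MvPolynomial.mem_restrictTotalDegree _ _ _).2 hr⟩ ⟨z, hz⟩
  simp only [LinearMap.comp_apply, Submodule.subtype_apply, AlgHom.toLinearMap_apply,
    MvPolynomial.aeval_eq_eval] at this
  rw [hfr z hz, this]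
  exact Finset.sum_congr rfl fun i _ => by rw [hfr _ (x i).2]

/-- Differentiation under the integral sign over a compact set, for a smooth function of fields
that depend linearly on finitely many parameters. -/
theorem hasFDerivAt_setIntegral_comp {X E G : Type*} [TopologicalSpace X] [MeasurableSpace X]
    [OpensMeasurableSpace X] [T2Space X] [SecondCountableTopology X]
    [NormedAddCommGroup E] [NormedSpace ℝ E]
    [FiniteDimensional ℝ E] [NormedAddCommGroup G] [NormedSpace ℝ G] [FiniteDimensional ℝ G]
    {μ : Measure X} [IsFiniteMeasureOnCompacts μ]
    {K : Set X} (hK : IsCompact K) {L : X → E →L[ℝ] G} (hL : Continuous L) {U : Set G}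
    (hU : IsOpen U) {h : G → ℝ} (hh : ∀ y ∈ U, ContDiffAt ℝ 1 h y) {c₀ : E}
    (hc₀ : ∀ x ∈ K, L x c₀ ∈ U) :
    HasFDerivAt (fun c => ∫ x in K, h (L x c) ∂μ)
      (∫ x in K, (fderiv ℝ h (L x c₀)).comp (L x) ∂μ) c₀ := by
  have hev : Continuous fun q : E × X => L q.2 q.1 := (hL.comp continuous_snd).clm_apply continuous_fst
  have hopen : IsOpen {q : E × X | L q.2 q.1 ∈ U} := hU.preimage hev
  -- By compactness of `K` one ball of parameters keeps all field values in `U`; on its product with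
  -- `K` the derivative is bounded, which provides the dominating constant.
  obtain ⟨u, w, hu, -, hcu, hKw, huw⟩ := generalized_tube_lemma (isCompact_singleton (x := c₀)) hK
    hopen (by rintro ⟨c, x⟩ ⟨hc, hx⟩; rw [mem_singleton_iff] at hc; subst hc; exact hc₀ x hx)
  obtain ⟨r, hr, hball⟩ := Metric.nhds_basis_closedBall.mem_iff.1 (hu.mem_nhds (hcu rfl))
  have hmemU : ∀ c ∈ Metric.closedBall c₀ r, ∀ x ∈ K, L x c ∈ U := fun c hc x hx =>
    huw (mk_mem_prod (hball hc) (hKw hx))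
  have hfd : ContinuousOn (fderiv ℝ h) U := fun y hy =>
    (((hh y hy).fderiv_right (m := 0) (by norm_num)).continuousAt).continuousWithinAt
  have hF' : ContinuousOn (fun q : E × X => (fderiv ℝ h (L q.2 q.1)).comp (L q.2))
      (Metric.closedBall c₀ r ×ˢ K) :=
    (hfd.comp hev.continuousOn fun q hq => hmemU q.1 hq.1 q.2 hq.2).clm_comp
      (hL.comp continuous_snd).continuousOn
  obtain ⟨C, hC⟩ := ((isCompact_closedBall c₀ r).prod hK).exists_bound_of_continuousOn hF'
  have hhc : ContinuousOn h U := fun y hy => (hh y hy).continuousAt.continuousWithinAt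
  have hFc : ∀ c ∈ Metric.closedBall c₀ r, ContinuousOn (fun x => h (L x c)) K := fun c hc =>
    hhc.comp (hL.clm_apply continuous_const).continuousOn fun x hx => hmemU c hc x hx
  have hcmem : c₀ ∈ Metric.closedBall c₀ r := Metric.mem_closedBall_self hr.le
  refine hasFDerivAt_integral_of_dominated_of_fderiv_le (bound := fun _ => C)
    (F' := fun c x => (fderiv ℝ h (L x c)).comp (L x)) (Metric.closedBall_mem_nhds c₀ hr)
    ?_ ?_ ?_ ?_ ?_ ?_
  · filter_upwards [Metric.closedBall_mem_nhds c₀ hr] with c hc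
    exact (hFc c hc).aestronglyMeasurable hK.measurableSet
  · exact (hFc c₀ hcmem).integrableOn_compact hK
  · refine ContinuousOn.aestronglyMeasurable ?_ hK.measurableSet
    exact hF'.comp (by fun_prop : Continuous fun x : X => (c₀, x)).continuousOn
      fun x hx => ⟨hcmem, hx⟩
  · filter_upwards [ae_restrict_mem hK.measurableSet] with x hx c hc
    exact hC (c, x) ⟨hc, hx⟩
  · have := hK.measure_lt_top (μ := μ)
    exact integrableOn_const this.ne
  · filter_upwards [ae_restrict_mem hK.measurableSet] with x hx c hc
    exact ((hh _ (hmemU c hc x hx)).differentiableAt (by norm_num)).hasFDerivAt.comp c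
      (L x).hasFDerivAt

theorem contDiff_eval_state {d m : ℕ} (q : Fin m → MvPolynomial (Fin d) ℝ) {n : ℕ∞} :
    ContDiff ℝ n fun x : Pt d => fun k => MvPolynomial.eval (fun j => x j) (q k) :=
  contDiff_pi.2 fun k => contDiff_mvPolynomial_eval (q k)

/-- Time derivative of the integral of a function of a time-dependent polynomial field, which is
only assumed to be pointwise differentiable in time. -/
theorem hasDerivWithinAt_setIntegral_polyOn {d m p : ℕ} {D : Set (Pt d)} (hD : IsCompact D)
    {U : Set (Fin m → ℝ)} (hU : IsOpen U) {h : (Fin m → ℝ) → ℝ}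
    (hh : ∀ y ∈ U, ContDiffAt ℝ 1 h y) {I : Set ℝ} {v : ℝ → Pt d → Fin m → ℝ}
    (hpoly : ∀ s ∈ I, ∀ k, PolyOn p D fun x => v s x k)
    (hdiff : ∀ x ∈ D, DifferentiableOn ℝ (fun s => v s x) I) {t : ℝ} (ht : t ∈ I)
    (huniq : UniqueDiffWithinAt ℝ I t) (hmem : ∀ x ∈ D, v t x ∈ U) :
    HasDerivWithinAt (fun s => ∫ x in D, h (v s x))
      (∫ x in D, fderiv ℝ h (v t x) (derivWithin (fun s => v s x) I t)) I t := by
  obtain ⟨n, x, φ, hxD, hφ, hint⟩ := PolyOn.exists_interpolation p D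
  set L : Pt d → (Fin n → Fin m → ℝ) →L[ℝ] (Fin m → ℝ) := fun z =>
    ∑ i, φ i z • ContinuousLinearMap.proj (R := ℝ) (φ := fun _ : Fin n => Fin m → ℝ) i with hLdef
  have hL : Continuous L := continuous_finsetSum _ fun i _ => (hφ i).smul continuous_const
  have hLapp : ∀ z c, L z c = ∑ i, φ i z • c i := by
    intro z c
    simp [hLdef]
  have hrep : ∀ s ∈ I, ∀ z ∈ D, v s z = L z fun i => v s (x i) := by
    intro s hs z hz
    funext k
    rw [hLapp, Finset.sum_apply, hint _ (hpoly s hs k) z hz]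
    exact Finset.sum_congr rfl fun i _ => by rw [Pi.smul_apply, smul_eq_mul, mul_comm]
  -- Time enters only through the finite vector of node values, so pointwise differentiability at
  -- the nodes is enough for the chain rule.
  set c : ℝ → Fin n → Fin m → ℝ := fun s i => v s (x i) with hcdef
  have hc : HasDerivWithinAt c (fun i => derivWithin (fun s => v s (x i)) I t) I t :=
    hasDerivWithinAt_pi.2 fun i => (hdiff _ (hxD i) t ht).hasDerivWithinAt
  have hmem' : ∀ z ∈ D, L z (c t) ∈ U := fun z hz => hrep t ht z hz ▸ hmem z hz
  have hF := hasFDerivAt_setIntegral_comp (μ := (volume : Measure (Pt d))) hD hL hU hh hmem'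
  have hcomp := hF.comp_hasDerivWithinAt t hc
  have hcongr : ∀ s ∈ I, ∫ z in D, h (v s z) = ∫ z in D, h (L z (c s)) := fun s hs =>
    setIntegral_congr_fun hD.measurableSet fun z hz => by rw [hrep s hs z hz]
  refine (hcomp.congr hcongr (hcongr t ht)).congr_deriv ?_
  have hfd : ContinuousOn (fderiv ℝ h) U := fun y hy =>
    (((hh y hy).fderiv_right (m := 0) (by norm_num)).continuousAt).continuousWithinAt
  have hintg : IntegrableOn (fun z => (fderiv ℝ h (L z (c t))).comp (L z)) D :=
    ((hfd.comp (hL.clm_apply continuous_const).continuousOn hmem').clm_comp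
      hL.continuousOn).integrableOn_compact hD
  rw [ContinuousLinearMap.integral_apply hintg]
  refine setIntegral_congr_fun hD.measurableSet fun z hz => ?_
  have hder : derivWithin (fun s => v s z) I t
      = L z fun i => derivWithin (fun s => v s (x i)) I t := by
    have h1 : HasDerivWithinAt (fun s => L z (c s))
        (L z fun i => derivWithin (fun s => v s (x i)) I t) I t :=
      (L z).hasFDerivAt.comp_hasDerivWithinAt t hc
    exact (h1.congr (fun s hs => hrep s hs z hz) (hrep t ht z hz)).derivWithin huniq
  simp only [ContinuousLinearMap.comp_apply]
  rw [hder, hrep t ht z hz]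

/-- The field is prescribed on `D` only; the smooth extension supplies derivatives up to the
boundary of `D`. -/
theorem PolyOn.exists_contDiff {d m p : ℕ} {D : Set (Pt d)} {f : Pt d → Fin m → ℝ}
    (hf : ∀ k, PolyOn p D fun x => f x k) :
    ∃ Q : Pt d → Fin m → ℝ, ContDiff ℝ 1 Q ∧ EqOn f Q D := by
  choose q _ hq using hf
  exact ⟨fun x k => MvPolynomial.eval (fun j => x j) (q k), contDiff_eval_state (n := 1) q,
    fun x hx => funext fun k => hq k x hx⟩

theorem PolyOn.continuousOn {d m p : ℕ} {D : Set (Pt d)} {f : Pt d → Fin m → ℝ}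
    (hf : ∀ k, PolyOn p D fun x => f x k) : ContinuousOn f D := by
  obtain ⟨Q, hQ, hfQ⟩ := PolyOn.exists_contDiff hf
  exact hQ.continuous.continuousOn.congr hfQ

theorem integrableOn_dotProduct {X : Type*} [TopologicalSpace X] [MeasurableSpace X]
    [OpensMeasurableSpace X] [T2Space X] {μ : Measure X} {m : ℕ} {K : Set X}
    (hK : IsCompact K) {f g : X → Fin m → ℝ} (hf : IntegrableOn f K μ) (hg : ContinuousOn g K) :
    IntegrableOn (fun x => f x ⬝ᵥ g x) K μ := by
  refine integrable_finsetSum _ fun k _ => ?_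
  exact IntegrableOn.mul_continuousOn (hf.eval k)
    ((continuous_apply k).comp_continuousOn hg) hK

/-! ### The volume flux term on one element. -/

section Cell

variable {d : ℕ} [NeZero d] (S : Affine.Simplex ℝ (Pt d) d) {γ : ℝ}

omit [NeZero d] in
theorem ae_mem_interior_closedInterior :
    ∀ᵐ x ∂(volume.restrict S.closedInterior), x ∈ interior S.closedInterior := by
  have h := (convex_closedInterior S).addHaar_frontier (volume : Measure (Pt d))
  have h' : ∀ᵐ x ∂(volume : Measure (Pt d)), x ∉ frontier S.closedInterior :=
    measure_eq_zero_iff_ae_notMem.1 h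
  filter_upwards [ae_restrict_of_ae h', ae_restrict_mem
    (isCompact_closedInterior S).measurableSet] with x hx hxS
  by_contra hxi
  exact hx ⟨subset_closure hxS, hxi⟩

/-- For a polynomial field of entropy variables, the volume integral of the flux against the
gradient of the field is the surface integral of the entropy potential. -/
theorem setIntegral_flux_fderiv (hγ : 1 < γ) {p : ℕ} {w : Pt d → State d}
    (hw : ∀ k, PolyOn p S.closedInterior fun x => w x k)
    (hadm : ∀ x ∈ S.closedInterior, Admissible (w x)) :
    ∫ x in S.closedInterior, ∑ j, flux γ (consVars γ (w x)) j ⬝ᵥ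
        fderiv ℝ w x (EuclideanSpace.single j 1)
      = ∑ m, ∫ x in (S.faceOpposite m).closedInterior,
          ∑ j, potential γ (w x) j * outNormal S m j ∂μHE[d - 1] := by
  obtain ⟨Q, hQ, hwQ⟩ := PolyOn.exists_contDiff hw
  have hadmQ : ∀ x ∈ S.closedInterior, Admissible (Q x) := fun x hx => hwQ hx ▸ hadm x hx
  have hΨ : ∀ j, ∀ x ∈ S.closedInterior, ContDiffAt ℝ 1 (fun x => potential γ (Q x) j) x :=
    fun j x hx => (contDiffAt_potential (hadmQ x hx) (n := 1) j).comp x hQ.contDiffAt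
  have hsub : ∀ m, (S.faceOpposite m).closedInterior ⊆ S.closedInterior :=
    S.closedInterior_faceOpposite_subset_closedInterior
  have h1 : ∫ x in S.closedInterior, ∑ j, flux γ (consVars γ (w x)) j ⬝ᵥ
        fderiv ℝ w x (EuclideanSpace.single j 1)
      = ∫ x in S.closedInterior, ∑ j, fderiv ℝ (fun x => potential γ (Q x) j) x
          (EuclideanSpace.single j 1) := by
    -- At frontier points `fderiv ℝ w` depends on values of `w` outside the element, which are
    -- arbitrary. The frontier is null, and at interior points `w` agrees with `Q` nearby.
    refine integral_congr_ae ?_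
    filter_upwards [ae_mem_interior_closedInterior S] with x hx
    have hxS := interior_subset hx
    have heq : w =ᶠ[𝓝 x] Q := by
      filter_upwards [isOpen_interior.mem_nhds hx] with z hz using hwQ (interior_subset hz)
    refine Finset.sum_congr rfl fun j _ => ?_
    rw [heq.fderiv_eq, hwQ hxS, ← fderiv_potential hγ (hadmQ x hxS)]
    have hc := fderiv_comp x (g := fun z : State d => potential γ z j) (f := Q)
      ((contDiffAt_potential (hadmQ x hxS) (n := 1) j).differentiableAt (by norm_num))
      (hQ.contDiffAt.differentiableAt (by norm_num))
    exact (congrArg (fun l => l (EuclideanSpace.single j 1)) hc).symm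
  rw [h1, integral_finsetSum _ fun j _ => (continuousOn_fderiv_of_contDiffAt (hΨ j)
    _).integrableOn_compact (isCompact_closedInterior S)]
  simp_rw [setIntegral_fderiv_simplex S (hΨ _)]
  rw [Finset.sum_comm]
  refine Finset.sum_congr rfl fun m _ => ?_
  have h2 : ∫ x in (S.faceOpposite m).closedInterior,
        ∑ j, potential γ (w x) j * outNormal S m j ∂μHE[d - 1]
      = ∫ x in (S.faceOpposite m).closedInterior,
        ∑ j, potential γ (Q x) j * outNormal S m j ∂μHE[d - 1] :=
    setIntegral_congr_fun (measurableSet_facet S m) fun x hx => by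
      simp only [hwQ (hsub m hx)]
  rw [h2, integral_finsetSum]
  · refine Finset.sum_congr rfl fun j _ => ?_
    rw [integral_mul_const, mul_comm]
    simp [EuclideanSpace.inner_single_right]
  · intro j _
    exact (integrableOn_facet S m ((continuousOn_of_contDiffAt (hΨ j)).mono (hsub m))).mul_const _

end Cell

/-! ### Sums of facet integrals and their cancellation. -/

section Facets

variable {d : ℕ} [NeZero d] {τ ι : Type*} [Fintype τ] (𝓣 : MacroMesh d τ ι)

theorem MacroMesh.facetInt_add {R : τ → Fin (d + 1) → Prop} {g h : τ → Fin (d + 1) → Pt d → ℝ}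
    (hg : ∀ a i, R a i → IntegrableOn (g a i) (𝓣.facet a i) μHE[d - 1])
    (hh : ∀ a i, R a i → IntegrableOn (h a i) (𝓣.facet a i) μHE[d - 1]) :
    𝓣.facetInt R (fun a i x => g a i x + h a i x) = 𝓣.facetInt R g + 𝓣.facetInt R h := by
  simp only [facetInt, ← Finset.sum_add_distrib]
  refine Finset.sum_congr rfl fun a _ => Finset.sum_congr rfl fun i _ => ?_
  split_ifs with hR
  · exact integral_add (hg a i hR) (hh a i hR)
  · rw [add_zero]

theorem MacroMesh.facetInt_sub {R : τ → Fin (d + 1) → Prop} {g h : τ → Fin (d + 1) → Pt d → ℝ}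
    (hg : ∀ a i, R a i → IntegrableOn (g a i) (𝓣.facet a i) μHE[d - 1])
    (hh : ∀ a i, R a i → IntegrableOn (h a i) (𝓣.facet a i) μHE[d - 1]) :
    𝓣.facetInt R (fun a i x => g a i x - h a i x) = 𝓣.facetInt R g - 𝓣.facetInt R h := by
  simp only [facetInt, ← Finset.sum_sub_distrib]
  refine Finset.sum_congr rfl fun a _ => Finset.sum_congr rfl fun i _ => ?_
  split_ifs with hR
  · exact integral_sub (hg a i hR) (hh a i hR)
  · rw [sub_zero]

theorem MacroMesh.facetInt_congr {R : τ → Fin (d + 1) → Prop} {g h : τ → Fin (d + 1) → Pt d → ℝ}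
    (hgh : ∀ a i, R a i → ∀ x ∈ 𝓣.facet a i, g a i x = h a i x) :
    𝓣.facetInt R g = 𝓣.facetInt R h := by
  unfold facetInt
  refine Finset.sum_congr rfl fun a _ => Finset.sum_congr rfl fun i _ => ?_
  split_ifs with hR
  · exact setIntegral_congr_fun (measurableSet_facet _ _) (hgh a i hR)
  · rfl

theorem MacroMesh.skelInt_eq (g : τ → Fin (d + 1) → Pt d → ℝ) :
    𝓣.skelInt g = 𝓣.skelIntInterior g + 𝓣.bdryInt g := by
  simp only [skelInt, skelIntInterior, bdryInt, facetInt, ← Finset.sum_add_distrib]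
  refine Finset.sum_congr rfl fun a _ => Finset.sum_congr rfl fun i _ => ?_
  by_cases hb : 𝓣.OnBoundary a i
  · simp [hb, hb.onMacroBoundary]
  · by_cases hm : 𝓣.OnMacroBoundary a i <;> simp [hb, hm]

/-- The fluxes of a single-valued vector field through the interior faces cancel. -/
theorem MacroMesh.skelIntInterior_normal_eq_zero (Φ : Set (Pt d) → Pt d → Fin d → ℝ) :
    𝓣.skelIntInterior (fun a i x => ∑ j, Φ (𝓣.facet a i) x j * 𝓣.normal a i j) = 0 := by
  refine 𝓣.sum_facets_eq_zero _ _ fun a i h => ?_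
  obtain ⟨b, i', hba, hF⟩ := 𝓣.exists_facet_eq_of_not_onBoundary h.2
  refine ⟨b, i', hba, ⟨h.1.of_facet_eq hF, fun hb => h.2 ((𝓣.onBoundary_congr hF).1 hb)⟩, hF, ?_⟩
  simp_rw [hF, 𝓣.normal_eq_neg hba.symm hF, PiLp.neg_apply, mul_neg, Finset.sum_neg_distrib]
  exact integral_neg _

/-- The fluxes of a vector field that is single-valued on each macro-element through the facets
of the elements sum up to the flux through the boundaries of the macro-elements. -/
theorem MacroMesh.sum_facets_eq_skelInt (Φ : ι → Pt d → Fin d → ℝ) :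
    ∑ a, ∑ i, ∫ x in 𝓣.facet a i, ∑ j, Φ (𝓣.mac a) x j * 𝓣.normal a i j ∂μHE[d - 1]
      = 𝓣.skelInt (fun a i x => ∑ j, Φ (𝓣.mac a) x j * 𝓣.normal a i j) := by
  classical
  have h0 := 𝓣.sum_facets_eq_zero (fun a i => ¬ 𝓣.OnMacroBoundary a i)
    (fun a i => ∫ x in 𝓣.facet a i, ∑ j, Φ (𝓣.mac a) x j * 𝓣.normal a i j ∂μHE[d - 1])
    fun a i h => by
      obtain ⟨b, i', hba, hm, hF⟩ := 𝓣.exists_facet_eq_of_not_onMacroBoundary h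
      refine ⟨b, i', hba, ?_, hF, ?_⟩
      · rwa [OnMacroBoundary, hF, hm]
      · simp_rw [hF, hm, 𝓣.normal_eq_neg hba.symm hF, PiLp.neg_apply, mul_neg,
          Finset.sum_neg_distrib]
        exact integral_neg _
  rw [← add_zero (𝓣.skelInt _), ← h0]
  simp only [skelInt, facetInt, ← Finset.sum_add_distrib]
  refine Finset.sum_congr rfl fun a _ => Finset.sum_congr rfl fun i _ => ?_
  by_cases h : 𝓣.OnMacroBoundary a i <;> simp [h]

end Facets

/-! ### The entropy balance of the scheme. -/

section Scheme

variable {d : ℕ} [NeZero d] {τ ι : Type*} [Fintype τ] {𝓣 : MacroMesh d τ ι} {γ : ℝ}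

theorem volInt_fluxGrad_self (hγ : 1 < γ) {p : ℕ} {w : VolFun d ι} (hw : w ∈ 𝓣.volSpace p)
    (hadm : ∀ a, ∀ x ∈ 𝓣.cell a, Admissible (w (𝓣.mac a) x)) :
    𝓣.volInt (fluxGrad 𝓣 γ w w) = 𝓣.skelInt (fun a i x =>
      ∑ j, potential γ (w (𝓣.mac a) x) j * 𝓣.normal a i j) := by
  rw [← 𝓣.sum_facets_eq_skelInt fun K x j => potential γ (w K x) j]
  exact Finset.sum_congr rfl fun a _ => setIntegral_flux_fderiv (𝓣.elem a) hγ (hw.2 a) (hadm a)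

omit [NeZero d] in
-- The chain rule through the conservative variables: `dH/dt = v · du/dt`.
theorem fderiv_genEntropy_derivWithin (hγ : 1 < γ) {I : Set ℝ} {t : ℝ}
    (huniq : UniqueDiffWithinAt ℝ I t) {y : ℝ → State d} (hy : DifferentiableWithinAt ℝ y I t)
    (hadm : Admissible (y t)) :
    fderiv ℝ (fun z : State d => genEntropy γ (consVars γ z)) (y t) (derivWithin y I t)
      = derivWithin (fun s => consVars γ (y s)) I t ⬝ᵥ y t := by
  have h := (((contDiffAt_consVars (γ := γ) hadm (n := 1)).differentiableAt
    (by norm_num)).hasFDerivAt.comp_hasDerivWithinAt t hy.hasDerivWithinAt).derivWithin huniq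
  rw [fderiv_genEntropy hγ hadm, ← h]
  rfl

omit [NeZero d] in
theorem hasDerivWithinAt_totalEntropy (hγ : 1 < γ) {p : ℕ} {I : Set ℝ} {v : ℝ → VolFun d ι}
    (hv : ∀ s ∈ I, v s ∈ 𝓣.volSpace p)
    (hdiff : ∀ a, ∀ x ∈ 𝓣.cell a, DifferentiableOn ℝ (fun s => v s (𝓣.mac a) x) I)
    {t : ℝ} (ht : t ∈ I) (huniq : UniqueDiffWithinAt ℝ I t)
    (hadm : ∀ a, ∀ x ∈ 𝓣.cell a, Admissible (v t (𝓣.mac a) x)) :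
    HasDerivWithinAt (fun s => totalEntropy 𝓣 γ (v s))
      (𝓣.volInt fun a x => derivWithin (fun s => consVars γ (v s (𝓣.mac a) x)) I t ⬝ᵥ
        v t (𝓣.mac a) x) I t := by
  refine HasDerivWithinAt.fun_sum fun a _ => ?_
  have h := hasDerivWithinAt_setIntegral_polyOn (isCompact_closedInterior (𝓣.elem a))
    (isOpen_admissible (d := d)) (h := fun z => genEntropy γ (consVars γ z))
    (fun y hy => contDiffAt_genEntropy hγ hy (n := 1)) (v := fun s => v s (𝓣.mac a))
    (fun s hs => (hv s hs).2 a) (hdiff a) ht huniq (hadm a)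
  refine h.congr_deriv (setIntegral_congr_fun (isCompact_closedInterior _).measurableSet
    fun x hx => ?_)
  exact fderiv_genEntropy_derivWithin hγ huniq (hdiff a x hx t ht) (hadm a x hx)

omit [Fintype τ] in
theorem integrableOn_facet_normal (a : τ) (i : Fin (d + 1)) {Φ : State d → Fin d → ℝ}
    {w : Pt d → State d} (hw : ContinuousOn w (𝓣.facet a i))
    (hΦ : ∀ x ∈ 𝓣.facet a i, ∀ j, ContinuousAt (fun z => Φ z j) (w x)) :
    IntegrableOn (fun x => ∑ j, Φ (w x) j * 𝓣.normal a i j) (𝓣.facet a i) μHE[d - 1] :=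
  integrable_finsetSum _ fun j _ => (integrableOn_facet (𝓣.elem a) i fun x hx =>
    ContinuousAt.comp_continuousWithinAt (g := fun z => Φ z j) (hΦ x hx j) (hw x hx)).mul_const _

omit [NeZero d] in
/-- The normal flux paired with the entropy variables is the sum of the normal components of the
entropy potential and of the entropy flux. -/
theorem dotProduct_sum_flux (hγ : 1 < γ) {y : State d} (hy : Admissible y) (n : Fin d → ℝ) :
    y ⬝ᵥ ∑ j, n j • flux γ (consVars γ y) j
      = ∑ j, potential γ y j * n j + ∑ j, entropyFlux γ (consVars γ y) j * n j := by
  rw [dotProduct_sum, ← Finset.sum_add_distrib]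
  refine Finset.sum_congr rfl fun j _ => ?_
  rw [dotProduct_smul, smul_eq_mul, dotProduct_comm, potential_eq hγ hy]
  ring

variable {Fhat : NumFlux d} {Bhat : BdryOp d} {p : ℕ} {Mh : Submodule ℝ (TraceFun d)} {T : ℝ}
  {vb : ℝ → Pt d → State d} {v : ℝ → VolFun d ι} {vh : ℝ → TraceFun d}

omit [Fintype τ] in
theorem mem_faces {a : τ} {i : Fin (d + 1)} (h : 𝓣.OnMacroBoundary a i) :
    𝓣.facet a i ∈ 𝓣.faces := ⟨a, i, h, rfl⟩

theorem IsSolution.entropy_identity (hγ : 1 < γ) (hMh : (Mh : Set (TraceFun d)) ⊆ 𝓣.traceSpace p)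
    (hsol : IsSolution 𝓣 γ Fhat Bhat p Mh T vb v vh) {t : ℝ} (ht : t ∈ Icc 0 T) :
    𝓣.volInt (fun a x => derivWithin (fun s => consVars γ (v s (𝓣.mac a) x)) (Icc 0 T) t ⬝ᵥ
        v t (𝓣.mac a) x)
      - entropyProduction 𝓣 γ Fhat (v t) (vh t)
      + bdryTerm 𝓣 γ Fhat Bhat (v t) (vh t) (vb t) = 0 := by
  -- The solution itself is an allowed test function; for the trace this only uses `v̂ ∈ Mh`, so any
  -- subspace `Mh` will do.
  have hlocal := hsol.local_eq t ht (v t) (hsol.mem_vol t ht)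
  have htrace := hsol.trace_eq t ht (vh t) (hsol.mem_trace t ht)
  rw [volInt_fluxGrad_self hγ (hsol.mem_vol t ht) (hsol.adm_vol t ht)] at hlocal
  have hcpt : ∀ a i, IsCompact (𝓣.facet a i) := fun a i => isCompact_closedInterior _
  have hvc : ∀ a i, ContinuousOn (v t (𝓣.mac a)) (𝓣.facet a i) := fun a i =>
    (PolyOn.continuousOn ((hsol.mem_vol t ht).2 a)).mono (𝓣.facet_subset_cell a i)
  have hvhc : ∀ a i, 𝓣.OnMacroBoundary a i →
      ContinuousOn (vh t (𝓣.facet a i)) (𝓣.facet a i) := fun a i h =>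
    PolyOn.continuousOn (hMh (hsol.mem_trace t ht) _ (mem_faces h))
  have hva : ∀ a i, ∀ x ∈ 𝓣.facet a i, Admissible (v t (𝓣.mac a) x) := fun a i x hx =>
    hsol.adm_vol t ht a x (𝓣.facet_subset_cell a i hx)
  have hvha : ∀ a i, 𝓣.OnMacroBoundary a i → ∀ x ∈ 𝓣.facet a i,
      Admissible (vh t (𝓣.facet a i) x) := fun a i h => hsol.adm_trace t ht _ (mem_faces h)
  -- Splitting the integrals below needs integrability of each piece. Numerical flux and boundary
  -- operator are merely integrable, but they are paired with fields continuous on the compact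
  -- facets.
  have hFv : ∀ a i, 𝓣.OnMacroBoundary a i → IntegrableOn (fun x =>
      fluxAt 𝓣 Fhat (v t) (vh t) a i x ⬝ᵥ v t (𝓣.mac a) x) (𝓣.facet a i) μHE[d - 1] :=
    fun a i h => integrableOn_dotProduct (hcpt a i) (hsol.int_flux t ht a i h) (hvc a i)
  have hFvh : ∀ a i, 𝓣.OnMacroBoundary a i → IntegrableOn (fun x =>
      fluxAt 𝓣 Fhat (v t) (vh t) a i x ⬝ᵥ vh t (𝓣.facet a i) x) (𝓣.facet a i) μHE[d - 1] :=
    fun a i h => integrableOn_dotProduct (hcpt a i) (hsol.int_flux t ht a i h) (hvhc a i h)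
  have hBvh : ∀ a i, 𝓣.OnBoundary a i → IntegrableOn (fun x =>
      bdryAt 𝓣 Bhat (v t) (vh t) (vb t) a i x ⬝ᵥ vh t (𝓣.facet a i) x)
      (𝓣.facet a i) μHE[d - 1] :=
    fun a i h => integrableOn_dotProduct (hcpt a i) (hsol.int_bdry t ht a i h)
      (hvhc a i h.onMacroBoundary)
  have hΨv : ∀ a i, 𝓣.OnMacroBoundary a i → IntegrableOn (fun x =>
      ∑ j, potential γ (v t (𝓣.mac a) x) j * 𝓣.normal a i j) (𝓣.facet a i) μHE[d - 1] :=
    fun a i _ => integrableOn_facet_normal a i (hvc a i) fun x hx j =>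
      (contDiffAt_potential (hva a i x hx) (n := 0) j).continuousAt
  have hΨvh : ∀ a i, 𝓣.OnMacroBoundary a i → IntegrableOn (fun x =>
      ∑ j, potential γ (vh t (𝓣.facet a i) x) j * 𝓣.normal a i j) (𝓣.facet a i) μHE[d - 1] :=
    fun a i h => integrableOn_facet_normal a i (hvhc a i h) fun x hx j =>
      (contDiffAt_potential (hvha a i h x hx) (n := 0) j).continuousAt
  have h𝓕vh : ∀ a i, 𝓣.OnMacroBoundary a i → IntegrableOn (fun x =>
      ∑ j, entropyFlux γ (consVars γ (vh t (𝓣.facet a i) x)) j * 𝓣.normal a i j)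
      (𝓣.facet a i) μHE[d - 1] :=
    fun a i h => integrableOn_facet_normal (Φ := fun z => entropyFlux γ (consVars γ z)) a i
      (hvhc a i h) fun x hx j => (contDiffAt_entropyFlux hγ (hvha a i h x hx) (n := 0) j).continuousAt
  have hprod : entropyProduction 𝓣 γ Fhat (v t) (vh t)
      = 𝓣.skelInt (fun a i x => fluxAt 𝓣 Fhat (v t) (vh t) a i x ⬝ᵥ vh t (𝓣.facet a i) x)
        - 𝓣.skelInt (fun a i x => fluxAt 𝓣 Fhat (v t) (vh t) a i x ⬝ᵥ v t (𝓣.mac a) x)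
        - (𝓣.skelInt (fun a i x => ∑ j, potential γ (vh t (𝓣.facet a i) x) j * 𝓣.normal a i j)
          - 𝓣.skelInt (fun a i x => ∑ j, potential γ (v t (𝓣.mac a) x) j * 𝓣.normal a i j)) := by
    simp only [MacroMesh.skelInt]
    rw [← 𝓣.facetInt_sub hFvh hFv, ← 𝓣.facetInt_sub hΨvh hΨv, ← 𝓣.facetInt_sub
      (g := fun a i x => fluxAt 𝓣 Fhat (v t) (vh t) a i x ⬝ᵥ vh t (𝓣.facet a i) x
        - fluxAt 𝓣 Fhat (v t) (vh t) a i x ⬝ᵥ v t (𝓣.mac a) x)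
      (h := fun a i x => ∑ j, potential γ (vh t (𝓣.facet a i) x) j * 𝓣.normal a i j
        - ∑ j, potential γ (v t (𝓣.mac a) x) j * 𝓣.normal a i j)
      (fun a i h => (hFvh a i h).sub (hFv a i h)) (fun a i h => (hΨvh a i h).sub (hΨv a i h))]
    refine 𝓣.facetInt_congr fun a i _ x _ => ?_
    rw [sub_dotProduct, dotProduct_comm, dotProduct_comm (v t _ x)]
  have hFB : 𝓣.bdryInt (fun a i x => vh t (𝓣.facet a i) x ⬝ᵥ
        (fluxAt 𝓣 Fhat (v t) (vh t) a i x - bdryAt 𝓣 Bhat (v t) (vh t) (vb t) a i x))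
      = 𝓣.bdryInt (fun a i x => fluxAt 𝓣 Fhat (v t) (vh t) a i x ⬝ᵥ vh t (𝓣.facet a i) x)
        - 𝓣.bdryInt (fun a i x =>
          bdryAt 𝓣 Bhat (v t) (vh t) (vb t) a i x ⬝ᵥ vh t (𝓣.facet a i) x) := by
    simp only [MacroMesh.bdryInt]
    rw [← 𝓣.facetInt_sub (fun a i h => hFvh a i h.onMacroBoundary) hBvh]
    refine 𝓣.facetInt_congr fun a i _ x _ => ?_
    rw [dotProduct_comm, sub_dotProduct]
  have hFn : 𝓣.bdryInt (fun a i x => vh t (𝓣.facet a i) x ⬝ᵥ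
        ∑ j, 𝓣.normal a i j • flux γ (consVars γ (vh t (𝓣.facet a i) x)) j)
      = 𝓣.bdryInt (fun a i x => ∑ j, potential γ (vh t (𝓣.facet a i) x) j * 𝓣.normal a i j)
        + 𝓣.bdryInt (fun a i x =>
          ∑ j, entropyFlux γ (consVars γ (vh t (𝓣.facet a i) x)) j * 𝓣.normal a i j) := by
    simp only [MacroMesh.bdryInt]
    rw [← 𝓣.facetInt_add (fun a i h => hΨvh a i h.onMacroBoundary)
      (fun a i h => h𝓕vh a i h.onMacroBoundary)]
    exact 𝓣.facetInt_congr fun a i h x hx =>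
      dotProduct_sum_flux hγ (hvha a i h.onMacroBoundary x hx) _
  -- Only the part over `∂Ω` survives, and there `hFn` trades `Ψ_n(v̂)` for `v̂ᵀ F_n - 𝓕_n`.
  have hΨskel := 𝓣.skelInt_eq fun a i x =>
    ∑ j, potential γ (vh t (𝓣.facet a i) x) j * 𝓣.normal a i j
  rw [𝓣.skelIntInterior_normal_eq_zero fun e x j => potential γ (vh t e x) j] at hΨskel
  have hFskel := 𝓣.skelInt_eq fun a i x =>
    fluxAt 𝓣 Fhat (v t) (vh t) a i x ⬝ᵥ vh t (𝓣.facet a i) x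
  rw [hprod, bdryTerm, hFB, hFn, hΨskel]
  linarith

end Scheme

end HDG

theorem proposition1 {d : ℕ} [NeZero d] {τ ι : Type*} [Fintype τ]
    (𝓣 : HDG.MacroMesh d τ ι) (p : ℕ) (Mh : Submodule ℝ (HDG.TraceFun d))
    (hMh : (Mh : Set (HDG.TraceFun d)) ⊆ 𝓣.traceSpace p)
    (γ : ℝ) (hγ : 1 < γ) (Fhat : HDG.NumFlux d) (Bhat : HDG.BdryOp d)
    (T : ℝ) (hT : 0 < T) (vb : ℝ → HDG.Pt d → HDG.State d)
    (v : ℝ → HDG.VolFun d ι) (vh : ℝ → HDG.TraceFun d)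
    (hsol : HDG.IsSolution 𝓣 γ Fhat Bhat p Mh T vb v vh) :
    (∀ y : HDG.State d, HDG.Admissible y → ∀ j : Fin d,
      HDG.potential γ y j =
        HDG.flux γ (HDG.consVars γ y) j ⬝ᵥ y - HDG.entropyFlux γ (HDG.consVars γ y) j) ∧
    ∀ t ∈ Set.Icc 0 T, ∃ D : ℝ,
      HasDerivWithinAt (fun s => HDG.totalEntropy 𝓣 γ (v s)) D (Set.Icc 0 T) t ∧
      D - HDG.entropyProduction 𝓣 γ Fhat (v t) (vh t)
        + HDG.bdryTerm 𝓣 γ Fhat Bhat (v t) (vh t) (vb t) = 0 :=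
  ⟨fun _ hy j => HDG.potential_eq hγ hy j, fun t ht =>
    ⟨_, HDG.hasDerivWithinAt_totalEntropy hγ hsol.mem_vol hsol.diff ht
      -- `T > 0` makes derivatives within `[0, T]` unique, at the endpoints as well.
      (uniqueDiffOn_Icc hT t ht) (hsol.adm_vol t ht), hsol.entropy_identity hγ hMh ht⟩⟩
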